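/- Let $d\ge 4$, $P\in\mathbb R^d$, $m_+,m_->0$, $M=m_++m_-$, $\mu_\pm=m_\pm/M$, $\tilde\mu=(\mu_--\mu_+)/2$, $g=\sqrt{|P|^2+M^2}$, and for $\eta\in\mathbb R^d$ let $$T_{P,M,\mu_\pm}(\eta)=\sqrt{|\mu_+P-\eta|^2+\mu_+^2M^2}+\sqrt{|\mu_-P+\eta|^2+\mu_-^2M^2}-\sqrt{|P|^2+M^2}.$$ For $u\ge 0$ put $$G^d_{P,M,\tilde\mu}(u)=\frac{3|B_1^d|}{(4\pi)^d}\,\frac{u^{d/2}(u+g)(u+2g)^{d/2}}{(u^2+2ug+M^2)^{1/2}}\left(\frac{u^2+2ug+(1-4\tilde\mu^2)M^2}{u^2+2ug+M^2}\right)^{d/2},$$ where $|B_1^d|$ is the volume of the unit ball of $\mathbb R^d$. (i) For every $u\ge0$ the set $\{\eta\in\mathbb R^d: T_{P,M,\mu_\pm}(\eta)<u\}$ has finite Lebesgue measure, and $$G^d_{P,M,\tilde\mu}(u)=\frac{3}{(2\pi)^d}\,\bigl|\{\eta\in\mathbb R^d: T_{P,M,\mu_\pm}(\eta)<u\}\bigr|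 .$$ (ii) Let $V:\mathbb R^d\to\mathbb R$ be measurable and relatively form compact with respect to $T_{P,M,\mu_\pm}(q)$, $q=-i\nabla$; that is, $(T_{P,M,\mu_\pm}(q)+1)^{-1/2}|V|(T_{P,M,\mu_\pm}(q)+1)^{-1/2}$ is a compact operator on $L^2(\mathbb R^d)$. Let $H_{\mathrm{rel},m_\pm}(P)=T_{P,M,\mu_\pm}(q)+V$ be the self-adjoint operator on $L^2(\mathbb R^d)$ defined as a sum of quadratic forms on the form domain of $T_{P,M,\mu_\pm}(q)$, and let $N(H_{\mathrm{rel},m_\pm}(P))$ be the number of its strictly negative eigenvalues, counted with multiplicity. Then, with $V_-=\max(0,-V)$, for every $0<\alpha<\tfrac14$, $$N(H_{\mathrm{rel},m_\pm}(P))\le\frac{\alpha^2}{(1-4\alpha)^2}\int_{\mathbb R^d}G^d_{P,M,\tilde\mu}\bigl(V_-(x)/\alpha^2\bigr)\,dx ,$$ where the right-hand side may be $+\infty$. -/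

import Mathlib

open MeasureTheory
open scoped FourierTransform ENNReal ComplexConjugate

noncomputable section

/-- The complex Hilbert space `L²(ℝᵈ)`. -/
abbrev L2Space (d : ℕ) : Type :=
  Lp ℂ 2 (volume : Measure (EuclideanSpace ℝ (Fin d)))

/-- The maximal domain `{f ∈ L² : m f ∈ L²}` of multiplication by the real function `m`. -/
def mulDomain {d : ℕ} (m : EuclideanSpace ℝ (Fin d) → ℝ) : Submodule ℂ (L2Space d) where
  carrier := {f | MemLp (fun x => ((m x : ℝ) : ℂ) * f x) 2 volume}
  zero_mem' := by
    refine (memLp_congr_ae ?_).mpr (MemLp.zero (ε := ℂ) (p := 2) (μ := volume)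
      (α := EuclideanSpace ℝ (Fin d)))
    filter_upwards [Lp.coeFn_zero ℂ 2 (volume : Measure (EuclideanSpace ℝ (Fin d)))] with x hx
    rw [hx, Pi.zero_apply, mul_zero]
  add_mem' := by
    intro a b ha hb
    refine (memLp_congr_ae ?_).mpr (MemLp.add ha hb)
    filter_upwards [Lp.coeFn_add a b] with x hx
    rw [hx, Pi.add_apply, Pi.add_apply, mul_add]
  smul_mem' := by
    intro c a ha
    refine (memLp_congr_ae ?_).mpr (MemLp.const_smul ha c)
    filter_upwards [Lp.coeFn_smul c a] with x hx
    rw [hx, Pi.smul_apply, Pi.smul_apply, smul_eq_mul, smul_eq_mul, mul_left_comm]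

theorem mem_mulDomain {d : ℕ} {m : EuclideanSpace ℝ (Fin d) → ℝ} {f : L2Space d} :
    f ∈ mulDomain m ↔ MemLp (fun x => ((m x : ℝ) : ℂ) * f x) 2 volume :=
  Iff.rfl

/-- Multiplication by the real function `m` on `L²(ℝᵈ)`, on its maximal domain. -/
def mulOperator {d : ℕ} (m : EuclideanSpace ℝ (Fin d) → ℝ) : L2Space d →ₗ.[ℂ] L2Space d where
  domain := mulDomain m
  toFun :=
    { toFun := fun f => (mem_mulDomain.mp f.2).toLp
      map_add' := by
        intro a b
        apply Lp.ext
        filter_upwards [(mem_mulDomain.mp a.2).coeFn_toLp, (mem_mulDomain.mp b.2).coeFn_toLp,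
          (mem_mulDomain.mp (a + b).2).coeFn_toLp, Lp.coeFn_add (a : L2Space d) (b : L2Space d),
          Lp.coeFn_add (mem_mulDomain.mp a.2).toLp (mem_mulDomain.mp b.2).toLp] with x h1 h2 h3 h4 h5
        rw [h3, h5, Pi.add_apply, h1, h2, Submodule.coe_add, h4, Pi.add_apply, mul_add]
      map_smul' := by
        intro c a
        apply Lp.ext
        filter_upwards [(mem_mulDomain.mp a.2).coeFn_toLp, (mem_mulDomain.mp (c • a).2).coeFn_toLp,
          Lp.coeFn_smul c (a : L2Space d), Lp.coeFn_smul c (mem_mulDomain.mp a.2).toLp]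
          with x h1 h2 h3 h4
        rw [h2, RingHom.id_apply, h4, Pi.smul_apply, h1, Submodule.coe_smul, h3, Pi.smul_apply,
          smul_eq_mul, smul_eq_mul, mul_left_comm] }

/-- The Fourier multiplier `m(p) = 𝓕⁻¹ m 𝓕`, `p = -i∇`, on its maximal domain. Mathlib's unitary `𝓕`
on `L²` extends `𝓕 f ξ = ∫ exp (-2πi ⟪x, ξ⟫) f x dx`, so that the momentum `p` acts in Fourier space
as multiplication by `2π ξ`, and `m(p)` as multiplication by `m (2π ξ)`. -/
def fourierMultiplier {d : ℕ} (m : EuclideanSpace ℝ (Fin d) → ℝ) : L2Space d →ₗ.[ℂ] L2Space d where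
  domain := (mulOperator fun ξ => m ((2 * Real.pi) • ξ)).domain.comap
    (Lp.fourierTransformₗᵢ (EuclideanSpace ℝ (Fin d)) ℂ).toLinearEquiv.toLinearMap
  toFun := (Lp.fourierTransformₗᵢ (EuclideanSpace ℝ (Fin d)) ℂ).symm.toLinearEquiv.toLinearMap ∘ₗ
    (mulOperator fun ξ => m ((2 * Real.pi) • ξ)).toFun ∘ₗ
      (Lp.fourierTransformₗᵢ (EuclideanSpace ℝ (Fin d)) ℂ).toLinearEquiv.toLinearMap.restrict
        fun _ hψ => hψ

/-- The form domain `𝒬(T(p)) = D(√T(p))` of the kinetic energy `T(p)`, for a symbol `T ≥ 0`. -/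
def kineticFormDomain {d : ℕ} (T : EuclideanSpace ℝ (Fin d) → ℝ) : Submodule ℂ (L2Space d) :=
  (fourierMultiplier fun η => √(T η)).domain

/-- The form domain `𝒬(V) = D(√|V|) = {ψ : ∫ |V| |ψ|² < ∞}` of the potential `V`. -/
def potentialFormDomain {d : ℕ} (V : EuclideanSpace ℝ (Fin d) → ℝ) : Submodule ℂ (L2Space d) :=
  mulDomain fun x => √|V x|

/-- `V` is relatively form compact with respect to `T(p)`: the operator
`(T(p) + 1)^{-1/2} |V| (T(p) + 1)^{-1/2}`, given by the form
`(φ, ψ) ↦ ∫ |V| conj ((T(p) + 1)^{-1/2} φ) ((T(p) + 1)^{-1/2} ψ)`, is compact on `L²(ℝᵈ)`.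
For a measurable `T ≥ 0` the multiplier `(T(p) + 1)^{-1/2}` is defined on all of `L²(ℝᵈ)`. -/
def IsRelativelyFormCompact {d : ℕ} (T V : EuclideanSpace ℝ (Fin d) → ℝ) : Prop :=
  ∃ K : L2Space d →L[ℂ] L2Space d, IsCompactOperator K ∧
    ∀ φ ψ : (fourierMultiplier fun η => (√(T η + 1))⁻¹).domain,
      Integrable (fun x => ((|V x| : ℝ) : ℂ) *
        (conj ((fourierMultiplier (fun η => (√(T η + 1))⁻¹) φ : L2Space d) x) *
          (fourierMultiplier (fun η => (√(T η + 1))⁻¹) ψ : L2Space d) x)) volume ∧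
      inner ℂ (φ : L2Space d) (K ψ) = ∫ x, ((|V x| : ℝ) : ℂ) *
        (conj ((fourierMultiplier (fun η => (√(T η + 1))⁻¹) φ : L2Space d) x) *
          (fourierMultiplier (fun η => (√(T η + 1))⁻¹) ψ : L2Space d) x)

/-- The form domain of `T(p) + V`. If `V` is relatively form compact with respect to `T(p)`, then
`𝒬(T(p)) ⊆ 𝒬(V)` and this is `𝒬(T(p))`. -/
def schrodingerFormDomain {d : ℕ} (T V : EuclideanSpace ℝ (Fin d) → ℝ) :
    Submodule ℂ (L2Space d) :=
  kineticFormDomain T ⊓ potentialFormDomain V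

/-- The sesquilinear form `⟪√T(p) φ, √T(p) ψ⟫ + ∫ V conj(φ) ψ` of `T(p) + V`, for a symbol `T ≥ 0`
(conjugate linear in `φ`). -/
def schrodingerForm {d : ℕ} (T V : EuclideanSpace ℝ (Fin d) → ℝ) (φ ψ : L2Space d) : ℂ :=
  (∫ ξ, conj ((√(T ((2 * Real.pi) • ξ)) : ℂ) * (𝓕 φ : L2Space d) ξ) *
      ((√(T ((2 * Real.pi) • ξ)) : ℂ) * (𝓕 ψ : L2Space d) ξ)) +
    ∫ x, (V x : ℂ) * (conj (φ x) * ψ x)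

theorem schrodingerForm_integrable_kinetic {d : ℕ} {T : EuclideanSpace ℝ (Fin d) → ℝ}
    {φ ψ : L2Space d} (hφ : φ ∈ kineticFormDomain T) (hψ : ψ ∈ kineticFormDomain T) :
    Integrable (fun ξ => conj ((√(T ((2 * Real.pi) • ξ)) : ℂ) * (𝓕 φ : L2Space d) ξ) *
      ((√(T ((2 * Real.pi) • ξ)) : ℂ) * (𝓕 ψ : L2Space d) ξ)) volume :=
  MemLp.integrable_mul (MemLp.star (mem_mulDomain.mp hφ)) (mem_mulDomain.mp hψ)

theorem schrodingerForm_integrable_potential {d : ℕ} {V : EuclideanSpace ℝ (Fin d) → ℝ}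
    (hV : AEMeasurable V volume)
    {φ ψ : L2Space d} (hφ : φ ∈ potentialFormDomain V) (hψ : ψ ∈ potentialFormDomain V) :
    Integrable (fun x => (V x : ℂ) * (conj (φ x) * ψ x)) volume := by
  have h : Integrable (fun x => conj ((√|V x| : ℂ) * φ x) * ((√|V x| : ℂ) * ψ x)) volume :=
    MemLp.integrable_mul (MemLp.star (mem_mulDomain.mp hφ)) (mem_mulDomain.mp hψ)
  refine h.mono ?_ (Filter.Eventually.of_forall fun x => le_of_eq ?_)
  · exact (Complex.measurable_ofReal.comp_aemeasurable hV).aestronglyMeasurable.mul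
      ((Lp.aestronglyMeasurable φ).star.mul (Lp.aestronglyMeasurable ψ))
  · have hs : √|V x| * √|V x| = |V x| := Real.mul_self_sqrt (abs_nonneg _)
    simp only [norm_mul, RCLike.norm_conj, Complex.norm_real, Real.norm_eq_abs,
      abs_of_nonneg (Real.sqrt_nonneg _)]
    linear_combination (-(‖φ x‖ * ‖ψ x‖)) * hs

/-- The graph of the operator `T(p) + V` associated with the form: `(T(p) + V) ψ = χ` means that `ψ`
lies in the form domain and that the form at `(φ, ψ)` is `⟪φ, χ⟫` for all `φ` in the form domain. -/
def schrodingerGraph {d : ℕ} (T V : EuclideanSpace ℝ (Fin d) → ℝ) (hV : AEMeasurable V volume) :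
    Submodule ℂ (L2Space d × L2Space d) where
  carrier := {z | z.1 ∈ schrodingerFormDomain T V ∧
    ∀ φ ∈ schrodingerFormDomain T V, schrodingerForm T V φ z.1 = inner ℂ φ z.2}
  zero_mem' := by
    refine ⟨Submodule.zero_mem _, fun φ _ => ?_⟩
    have h0 : (𝓕 (0 : L2Space d) : L2Space d) = 0 :=
      (Lp.fourierTransformₗᵢ (EuclideanSpace ℝ (Fin d)) ℂ).map_zero
    have hz := Lp.coeFn_zero ℂ 2 (volume : Measure (EuclideanSpace ℝ (Fin d)))
    simp only [schrodingerForm, Prod.fst_zero, Prod.snd_zero, inner_zero_right, h0]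
    rw [integral_eq_zero_of_ae, integral_eq_zero_of_ae, add_zero]
    · filter_upwards [hz] with x hx
      rw [hx, Pi.zero_apply, mul_zero, mul_zero]
    · filter_upwards [hz] with x hx
      rw [hx, Pi.zero_apply, mul_zero, mul_zero]
  add_mem' := by
    rintro ⟨a, a'⟩ ⟨b, b'⟩ ⟨ha, ha'⟩ ⟨hb, hb'⟩
    refine ⟨Submodule.add_mem _ ha hb, fun φ hφ => ?_⟩
    rw [Prod.snd_add, inner_add_right, ← ha' φ hφ, ← hb' φ hφ]
    simp only [schrodingerForm, Prod.mk_add_mk]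
    rw [add_add_add_comm, ← integral_add (schrodingerForm_integrable_kinetic hφ.1 ha.1)
        (schrodingerForm_integrable_kinetic hφ.1 hb.1),
      ← integral_add (schrodingerForm_integrable_potential hV hφ.2 ha.2)
        (schrodingerForm_integrable_potential hV hφ.2 hb.2)]
    congr 1
    · refine integral_congr_ae ?_
      rw [FourierTransform.fourier_add]
      filter_upwards [Lp.coeFn_add (𝓕 a : L2Space d) (𝓕 b)] with x hx
      rw [hx, Pi.add_apply]
      ring
    · refine integral_congr_ae ?_
      filter_upwards [Lp.coeFn_add a b] with x hx
      rw [hx, Pi.add_apply]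
      ring
  smul_mem' := by
    rintro c ⟨a, a'⟩ ⟨ha, ha'⟩
    refine ⟨Submodule.smul_mem _ c ha, fun φ hφ => ?_⟩
    rw [Prod.smul_snd, inner_smul_right, ← ha' φ hφ]
    simp only [schrodingerForm, Prod.smul_mk]
    rw [mul_add, ← integral_const_mul, ← integral_const_mul]
    congr 1
    · refine integral_congr_ae ?_
      rw [FourierTransform.fourier_smul]
      filter_upwards [Lp.coeFn_smul c (𝓕 a : L2Space d)] with x hx
      rw [hx, Pi.smul_apply, smul_eq_mul]
      ring
    · refine integral_congr_ae ?_
      filter_upwards [Lp.coeFn_smul c a] with x hx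
      rw [hx, Pi.smul_apply, smul_eq_mul]
      ring

/-- The eigenspace `{ψ ∈ D(T(p) + V) : (T(p) + V) ψ = E ψ}`. -/
def schrodingerEigenspace {d : ℕ} (T V : EuclideanSpace ℝ (Fin d) → ℝ)
    (hV : AEMeasurable V volume) (E : ℝ) : Submodule ℂ (L2Space d) :=
  (schrodingerGraph T V hV).comap (LinearMap.id.prod ((E : ℂ) • LinearMap.id))

/-- `N(T(p) + V)`: the number of strictly negative eigenvalues of `T(p) + V`, counted with
multiplicity, as an element of `[0, ∞]`. -/
def negativeEigenvalueCount {d : ℕ} (T V : EuclideanSpace ℝ (Fin d) → ℝ)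
    (hV : AEMeasurable V volume) : ℝ≥0∞ :=
  ∑' E : Set.Iio (0 : ℝ),
    (((Module.rank ℂ (schrodingerEigenspace T V hV E)).toENat : ℕ∞) : ℝ≥0∞)

/-- The kinetic energy of the relativistic pair operator with masses `mp = m₊`, `mm = m₋` and total
momentum `P`: with `M = m₊ + m₋` and `μ± = m± / M`,
`√(|μ₊ P - η|² + μ₊² M²) + √(|μ₋ P + η|² + μ₋² M²) - √(|P|² + M²)`. -/
def pairSymbol {d : ℕ} (P : EuclideanSpace ℝ (Fin d)) (mp mm : ℝ)
    (η : EuclideanSpace ℝ (Fin d)) : ℝ :=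
  √(‖(mp / (mp + mm)) • P - η‖ ^ 2 + (mp / (mp + mm)) ^ 2 * (mp + mm) ^ 2) +
    √(‖(mm / (mp + mm)) • P + η‖ ^ 2 + (mm / (mp + mm)) ^ 2 * (mp + mm) ^ 2) -
    √(‖P‖ ^ 2 + (mp + mm) ^ 2)

/-- The function `G^d_{P, M, μ}` of `u ≥ 0`, with `g = √(|P|² + M²)`. -/
def pairG {d : ℕ} (P : EuclideanSpace ℝ (Fin d)) (M μ u : ℝ) : ℝ :=
  let g : ℝ := √(‖P‖ ^ 2 + M ^ 2)
  3 * volume.real (Metric.ball (0 : EuclideanSpace ℝ (Fin d)) 1) / (4 * Real.pi) ^ d *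
    (u ^ ((d : ℝ) / 2) * (u + g) * (u + 2 * g) ^ ((d : ℝ) / 2) / √(u ^ 2 + 2 * u * g + M ^ 2)) *
    ((u ^ 2 + 2 * u * g + (1 - 4 * μ ^ 2) * M ^ 2) / (u ^ 2 + 2 * u * g + M ^ 2)) ^ ((d : ℝ) / 2)

end

/-! Write τ(ξ) = T(2πξ) and v = V_-. The counting bound follows Cwikel's method. On the span of n
orthonormal eigenfunctions with negative eigenvalues the form is nonpositive. Since τ > 0 almost
everywhere, this span has a basis ψ_j with the functions u_j = √τ 𝓕ψ_j orthonormal. Each ψ_j has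
kinetic energy 1, so ∫ v |ψ_j|² ≥ 1 (`exists_kinetic_orthonormal`, `one_le_lintegral_negPart_mul`).

On the set where v/α² lies in [4^a, 4^(a+1)), cut ψ_j at the energy τ = 4^a. Plancherel and a
geometric series bound the high parts by 16α² in total. A weighted splitting of |ψ_j|² then leaves
at least (1 - 4α)² for the low parts. The value of a low part at x is the inner product of u_j with
a function of squared norm ∫_{τ < 4^a} 1/τ, so Bessel's inequality bounds the sum over j by an
integral independent of n. Hence n (1 - 4α)² ≤ ∫ v(x) ∫_{τ < v(x)/α²} 1/τ dξ dx
(`card_mul_le_lintegral_of_one_le`).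

For the pair symbol, squaring twice turns T < u into a quadratic inequality, so the sublevel set is
an ellipsoid, with explicit volume (`pairSymbol_lt_iff`, `volume_ellipsoid`). This is (i). For d ≥ 4
the volume grows at least like u^(3/2), in the sense that u^(-3/2) G(u) is nondecreasing. A
layer-cake integral then gives ∫_{τ < u} 1/τ ≤ 3 |{τ < u}| / u = G(u)/u, and u = v/α² yields (ii).
-/

/-! ### Frequency cut-offs in L² and Bessel's inequality -/

open scoped SchwartzMap ContDiff in
/-- On `L¹ ∩ L²` the `L²` inverse Fourier transform is given by the Fourier integral. -/
theorem coeFn_fourierInv_ae_eq {d : ℕ} (F : L2Space d) (hF : Integrable F volume) :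
    ∀ᵐ x, (𝓕⁻ F : L2Space d) x = ∫ ξ, (Real.fourierChar (inner ℝ ξ x) : ℂ) * F ξ := by
  have hcont : Continuous fun p : EuclideanSpace ℝ (Fin d) × EuclideanSpace ℝ (Fin d) =>
      (-innerₗ (EuclideanSpace ℝ (Fin d))) p.1 p.2 := by
    simp only [LinearMap.neg_apply, innerₗ_apply_apply]
    fun_prop
  have key : ∀ᵐ x, (𝓕⁻ F : L2Space d) x =
      (𝓕⁻ (F : EuclideanSpace ℝ (Fin d) → ℂ)) x := by
    -- Test against smooth compactly supported g. The transform passes to g on the left by duality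
    -- of tempered distributions, and on the right by Fubini.
    refine ae_eq_of_integral_contDiff_smul_eq ((Lp.memLp _).locallyIntegrable one_le_two)
      (Continuous.locallyIntegrable ?_) fun g g_smooth g_cpt => ?_
    · exact VectorFourier.fourierIntegral_continuous Real.continuous_fourierChar hcont hF
    · have hg₁ : HasCompactSupport (Complex.ofRealCLM ∘ g) := g_cpt.comp_left rfl
      have hg₂ : ContDiff ℝ ∞ (Complex.ofRealCLM ∘ g) := by fun_prop
      set G := hg₁.toSchwartzMap hg₂ with hG
      have hGx : ∀ x, G x = (g x : ℂ) := fun x => rfl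
      have h1 : ∫ x, g x • (𝓕⁻ F : L2Space d) x = Lp.toTemperedDistribution (𝓕⁻ F) G := by
        simp [hG]
      rw [h1, ← Lp.fourierInv_toTemperedDistribution_eq, TemperedDistribution.fourierInv_apply,
        Lp.toTemperedDistribution_apply]
      have h2 := VectorFourier.integral_fourierIntegral_smul_eq_flip (μ := volume) (ν := volume)
        (f := G) (g := F) Real.continuous_fourierChar hcont (G.integrable) hF
      have hflip : (-innerₗ (EuclideanSpace ℝ (Fin d))).flip
          = -innerₗ (EuclideanSpace ℝ (Fin d)) := by
        ext x y
        simp [real_inner_comm]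
      rw [hflip] at h2
      simp only [SchwartzMap.fourierInv_coe]
      refine h2.trans (integral_congr_ae (Filter.Eventually.of_forall fun x => ?_))
      simp only [hGx, Complex.real_smul, smul_eq_mul]
      rfl
  filter_upwards [key] with x hx
  rw [hx, Real.fourierInv_eq]
  simp only [Circle.smul_def, smul_eq_mul]

/-- `∫ |f|² = ‖f‖²` on `L²`, as a lower integral. -/
theorem lintegral_enorm_sq_eq {d : ℕ} (f : L2Space d) :
    ∫⁻ x, ‖f x‖ₑ ^ 2 = ENNReal.ofReal (‖f‖ ^ 2) := by
  have h := Lp.enorm_def f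
  rw [eLpNorm_eq_lintegral_rpow_enorm_toReal (by norm_num) (by norm_num)] at h
  simp only [ENNReal.toReal_ofNat, one_div, ENNReal.rpow_ofNat] at h
  rw [ENNReal.ofReal_pow (norm_nonneg _), ofReal_norm, h, ← ENNReal.rpow_natCast,
    ← ENNReal.rpow_mul]
  norm_num

/-- Restriction of an `L²` function to a measurable set, extended by zero. -/
noncomputable def indicatorL2 {d : ℕ} {S : Set (EuclideanSpace ℝ (Fin d))} (hS : MeasurableSet S)
    (f : L2Space d) : L2Space d :=
  ((Lp.memLp f).indicator hS).toLp

theorem coeFn_indicatorL2 {d : ℕ} {S : Set (EuclideanSpace ℝ (Fin d))} (hS : MeasurableSet S)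
    (f : L2Space d) : indicatorL2 hS f =ᵐ[volume] S.indicator f :=
  MemLp.coeFn_toLp _

theorem indicatorL2_add_compl {d : ℕ} {S : Set (EuclideanSpace ℝ (Fin d))} (hS : MeasurableSet S)
    (f : L2Space d) : indicatorL2 hS f + indicatorL2 hS.compl f = f := by
  apply Lp.ext
  filter_upwards [Lp.coeFn_add (indicatorL2 hS f) (indicatorL2 hS.compl f),
    coeFn_indicatorL2 hS f, coeFn_indicatorL2 hS.compl f] with x h1 h2 h3
  rw [h1, Pi.add_apply, h2, h3, ← Pi.add_apply, Set.indicator_self_add_compl]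

/-- Plancherel for a sharp frequency cut-off. -/
theorem lintegral_enorm_sq_fourierInv_indicatorL2 {d : ℕ} {S : Set (EuclideanSpace ℝ (Fin d))}
    (hS : MeasurableSet S) (f : L2Space d) :
    ∫⁻ x, ‖(𝓕⁻ (indicatorL2 hS f) : L2Space d) x‖ₑ ^ 2 = ∫⁻ ξ in S, ‖f ξ‖ₑ ^ 2 := by
  have h : ‖(𝓕⁻ (indicatorL2 hS f) : L2Space d)‖ = ‖indicatorL2 hS f‖ :=
    (Lp.fourierTransformₗᵢ (EuclideanSpace ℝ (Fin d)) ℂ).symm.norm_map _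
  rw [lintegral_enorm_sq_eq, h, ← lintegral_enorm_sq_eq, ← lintegral_indicator hS]
  refine lintegral_congr_ae ?_
  filter_upwards [coeFn_indicatorL2 hS f] with x hx
  rw [hx]
  by_cases hxS : x ∈ S <;> simp [hxS]

/-- Bessel's inequality for the low-energy parts `𝓕⁻ (1_{τ < t} F j)` at almost every point, when
the functions `√τ F j` are orthonormal. -/
theorem sum_enorm_sq_fourierInv_low_le {d : ℕ} {τ : EuclideanSpace ℝ (Fin d) → ℝ}
    (hτ : Measurable τ) (hpos : ∀ᵐ ξ, 0 < τ ξ) {t : ℝ} (hvol : volume {ξ | τ ξ < t} ≠ ⊤)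
    (hfin : ∫⁻ ξ in {ξ | τ ξ < t}, ENNReal.ofReal (τ ξ)⁻¹ ≠ ⊤)
    {ι : Type*} [Fintype ι] {u F : ι → L2Space d} (hu : Orthonormal ℂ u)
    (huF : ∀ j, u j =ᵐ[volume] fun ξ => (√(τ ξ) : ℂ) * F j ξ) :
    ∀ᵐ x, ∑ j, ‖(𝓕⁻ (indicatorL2 (measurableSet_lt hτ measurable_const : MeasurableSet
        {ξ | τ ξ < t}) (F j)) : L2Space d) x‖ₑ ^ 2 ≤
      ∫⁻ ξ in {ξ | τ ξ < t}, ENNReal.ofReal (τ ξ)⁻¹ := by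
  have hS : MeasurableSet {ξ | τ ξ < t} := measurableSet_lt hτ measurable_const
  have hint : ∀ j, Integrable (indicatorL2 hS (F j)) volume := fun j => by
    rw [integrable_congr (coeFn_indicatorL2 hS (F j)), integrable_indicator_iff hS]
    have : IsFiniteMeasure (volume.restrict {ξ | τ ξ < t}) := ⟨by
      rw [Measure.restrict_apply_univ]; exact hvol.lt_top⟩
    exact ((Lp.memLp (F j)).restrict _).integrable one_le_two
  have hpt := fun j => coeFn_fourierInv_ae_eq (indicatorL2 hS (F j)) (hint j)
  filter_upwards [ae_all_iff.mpr hpt] with x hx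
  -- Dividing by √τ represents evaluation at x by pairing with `u j` instead of `F j`. The minus
  -- sign in the character is undone by conjugation in the first slot of the inner product.
  set k : EuclideanSpace ℝ (Fin d) → ℂ := {ξ | τ ξ < t}.indicator fun ξ =>
    (Real.fourierChar (-inner ℝ ξ x) : ℂ) * ((√(τ ξ))⁻¹ : ℝ) with hk
  have hkm : Measurable k := by
    refine Measurable.indicator ?_ hS
    refine Measurable.mul ?_ (Complex.measurable_ofReal.comp (hτ.sqrt.inv))
    have : Continuous fun ξ : EuclideanSpace ℝ (Fin d) =>
        (Real.fourierChar (-inner ℝ ξ x) : ℂ) :=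
      continuous_subtype_val.comp (Real.continuous_fourierChar.comp (by fun_prop))
    exact this.measurable
  have hknorm : ∫⁻ ξ, ‖k ξ‖ₑ ^ 2 = ∫⁻ ξ in {ξ | τ ξ < t}, ENNReal.ofReal (τ ξ)⁻¹ := by
    rw [← lintegral_indicator hS]
    refine lintegral_congr_ae ?_
    filter_upwards [hpos] with ξ hξ
    by_cases h : ξ ∈ {ξ | τ ξ < t}
    · rw [hk, Set.indicator_of_mem h, Set.indicator_of_mem h, ← ofReal_norm,
        ← ENNReal.ofReal_pow (norm_nonneg _), norm_mul, Circle.norm_coe, one_mul,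
        Complex.norm_real, Real.norm_eq_abs, sq_abs, inv_pow, Real.sq_sqrt hξ.le]
    · rw [hk, Set.indicator_of_notMem h, Set.indicator_of_notMem h]
      simp
  have hkmem : MemLp k 2 volume := by
    refine ⟨hkm.aestronglyMeasurable, ?_⟩
    rw [eLpNorm_lt_top_iff_lintegral_rpow_enorm_lt_top (by norm_num) (by norm_num)]
    simp only [ENNReal.toReal_ofNat, ENNReal.rpow_ofNat]
    rw [hknorm]
    exact hfin.lt_top
  have hin : ∀ j, (𝓕⁻ (indicatorL2 hS (F j)) : L2Space d) x = inner ℂ hkmem.toLp (u j) := by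
    intro j
    rw [hx j, L2.inner_def]
    refine integral_congr_ae ?_
    filter_upwards [hkmem.coeFn_toLp, huF j, coeFn_indicatorL2 hS (F j), hpos] with ξ h1 h2 h3 h4
    rw [h1, h2, h3, RCLike.inner_apply, hk]
    by_cases h : ξ ∈ {ξ | τ ξ < t}
    · rw [Set.indicator_of_mem h, Set.indicator_of_mem h, map_mul, Complex.conj_ofReal,
        AddChar.map_neg_eq_inv, Circle.coe_inv_eq_conj, Complex.conj_conj]
      have h5 : ((√(τ ξ) : ℝ) : ℂ) ≠ 0 := by
        exact_mod_cast (Real.sqrt_pos.mpr h4).ne'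
      push_cast
      field_simp
    · rw [Set.indicator_of_notMem h, Set.indicator_of_notMem h]
      simp
  have hB := hu.sum_inner_products_le (x := hkmem.toLp) (s := Finset.univ)
  calc ∑ j, ‖(𝓕⁻ (indicatorL2 hS (F j)) : L2Space d) x‖ₑ ^ 2
      = ENNReal.ofReal (∑ j, ‖inner ℂ (u j) hkmem.toLp‖ ^ 2) := by
        rw [ENNReal.ofReal_sum_of_nonneg fun _ _ => by positivity]
        refine Finset.sum_congr rfl fun j _ => ?_
        rw [hin j, ← ofReal_norm, ← ENNReal.ofReal_pow (norm_nonneg _), norm_inner_symm]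
    _ ≤ ENNReal.ofReal (‖hkmem.toLp‖ ^ 2) := ENNReal.ofReal_le_ofReal hB
    _ = ∫⁻ ξ, ‖k ξ‖ₑ ^ 2 := by
        rw [← lintegral_enorm_sq_eq]
        refine lintegral_congr_ae ?_
        filter_upwards [hkmem.coeFn_toLp] with ξ h1
        rw [h1]
    _ = _ := hknorm

/-! ### Geometric level sets of the potential and the high-energy part -/

/-- The geometric sum of the powers `4 ^ a ≤ y`, `a ∈ ℤ`. -/
theorem tsum_zpow_indicator_le {y : ℝ} (hy : 0 < y) :
    ∑' a : ℤ, (if (4 : ℝ) ^ a ≤ y then ENNReal.ofReal ((4 : ℝ) ^ a) else 0) ≤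
      ENNReal.ofReal (4 * y) := by
  obtain ⟨b, hb1, hb2⟩ := exists_mem_Ico_zpow hy (by norm_num : (1 : ℝ) < 4)
  have hle : ∀ a : ℤ, (if (4 : ℝ) ^ a ≤ y then ENNReal.ofReal ((4 : ℝ) ^ a) else 0) ≤
      if a ≤ b then ENNReal.ofReal ((4 : ℝ) ^ a) else 0 := by
    intro a
    by_cases h : (4 : ℝ) ^ a ≤ y
    · have : a < b + 1 := (zpow_lt_zpow_iff_right₀ (by norm_num : (1 : ℝ) < 4)).mp
        (h.trans_lt hb2)
      rw [if_pos h, if_pos (by omega)]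
    · rw [if_neg h]
      exact zero_le
  refine (ENNReal.tsum_le_tsum hle).trans ?_
  have hinj : Function.Injective fun n : ℕ => b - (n : ℤ) := fun m n h => by
    simpa using h
  rw [← hinj.tsum_eq]
  · have hs : HasSum (fun n : ℕ => (4 : ℝ) ^ b * (1 / 4) ^ n) ((4 : ℝ) ^ b * (1 - 1 / 4)⁻¹) :=
      (hasSum_geometric_of_lt_one (by norm_num) (by norm_num)).mul_left _
    have hterm : ∀ n : ℕ, (if b - (n : ℤ) ≤ b then ENNReal.ofReal ((4 : ℝ) ^ (b - (n : ℤ))) else 0)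
        = ENNReal.ofReal ((4 : ℝ) ^ b * (1 / 4) ^ n) := by
      intro n
      rw [if_pos (by omega), zpow_sub₀ (by norm_num), zpow_natCast, one_div, inv_pow,
        div_eq_mul_inv]
    simp only [hterm]
    rw [← ENNReal.ofReal_tsum_of_nonneg (fun n => by positivity) hs.summable, hs.tsum_eq]
    -- The sum equals 4/3 · 4^b ≤ 4/3 · y. The weaker 4 y suffices: it leads to the high-energy
    -- constant 16 α² = (4α)².
    apply ENNReal.ofReal_le_ofReal
    have : (0 : ℝ) < 4 ^ b := by positivity
    linarith
  · intro a ha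
    by_cases h : a ≤ b
    · exact ⟨(b - a).toNat, by simp only; omega⟩
    · simp [h] at ha

/-- The level sets `{4 ^ a s ≤ v < 4 ^ (a + 1) s}`. -/
def levelBin {X : Type*} (v : X → ℝ) (s : ℝ) (a : ℤ) : Set X :=
  {x | s * (4 : ℝ) ^ a ≤ v x ∧ v x < s * (4 : ℝ) ^ (a + 1)}

theorem measurableSet_levelBin {X : Type*} [MeasurableSpace X] {v : X → ℝ} (hv : Measurable v)
    (s : ℝ) (a : ℤ) : MeasurableSet (levelBin v s a) :=
  (measurableSet_le measurable_const hv).inter (measurableSet_lt hv measurable_const)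

theorem pairwise_disjoint_levelBin {X : Type*} (v : X → ℝ) {s : ℝ} (hs : 0 < s) :
    Pairwise (Function.onFun Disjoint (levelBin v s)) := by
  intro a b hab
  refine Set.disjoint_left.mpr fun x ⟨h1, h2⟩ ⟨h3, h4⟩ => hab ?_
  have h5 := (zpow_lt_zpow_iff_right₀ (by norm_num : (1 : ℝ) < 4)).mp
    (lt_of_mul_lt_mul_left (h1.trans_lt h4) hs.le)
  have h6 := (zpow_lt_zpow_iff_right₀ (by norm_num : (1 : ℝ) < 4)).mp
    (lt_of_mul_lt_mul_left (h3.trans_lt h2) hs.le)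
  omega

theorem iUnion_levelBin {X : Type*} (v : X → ℝ) {s : ℝ} (hs : 0 < s) :
    ⋃ a : ℤ, levelBin v s a = {x | 0 < v x} := by
  ext x
  simp only [Set.mem_iUnion, levelBin, Set.mem_ofPred_eq]
  constructor
  · rintro ⟨a, h1, -⟩
    exact lt_of_lt_of_le (by positivity) h1
  · intro h
    obtain ⟨a, h1, h2⟩ := exists_mem_Ico_zpow (div_pos h hs) (by norm_num : (1 : ℝ) < 4)
    rw [le_div_iff₀ hs] at h1
    rw [div_lt_iff₀ hs] at h2
    exact ⟨a, by linarith, by linarith⟩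

/-- The bins partition {v > 0}, and `ENNReal.ofReal (v x)` vanishes elsewhere. -/
theorem tsum_setLIntegral_levelBin {X : Type*} [MeasurableSpace X] {μ : Measure X} {v : X → ℝ}
    (hv : Measurable v) {s : ℝ} (hs : 0 < s) (f : X → ℝ≥0∞) :
    ∑' a : ℤ, ∫⁻ x in levelBin v s a, ENNReal.ofReal (v x) * f x ∂μ =
      ∫⁻ x, ENNReal.ofReal (v x) * f x ∂μ := by
  rw [← lintegral_iUnion (measurableSet_levelBin hv s) (pairwise_disjoint_levelBin v hs),
    iUnion_levelBin v hs, ← lintegral_indicator (measurableSet_lt measurable_const hv)]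
  congr 1
  ext x
  by_cases h : 0 < v x
  · rw [Set.indicator_of_mem (by exact h)]
  · rw [Set.indicator_of_notMem (by exact h), ENNReal.ofReal_of_nonpos (not_lt.mp h), zero_mul]

/-- The bound of Cwikel's type on the high-energy part. -/
theorem tsum_levelBin_fourierInv_high_le {d : ℕ} {τ v : EuclideanSpace ℝ (Fin d) → ℝ}
    (hτ : Measurable τ) (hpos : ∀ᵐ ξ, 0 < τ ξ) (hv : Measurable v) {s : ℝ} (hs : 0 < s)
    (F : L2Space d) :
    ∑' a : ℤ, ∫⁻ x in levelBin v s a, ENNReal.ofReal (v x) *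
        ‖(𝓕⁻ (indicatorL2 (measurableSet_lt hτ measurable_const : MeasurableSet
          {ξ | τ ξ < (4 : ℝ) ^ a}).compl F) : L2Space d) x‖ₑ ^ 2 ≤
      ENNReal.ofReal (16 * s) * ∫⁻ ξ, ENNReal.ofReal (τ ξ) * ‖F ξ‖ₑ ^ 2 := by
  have hS : ∀ a : ℤ, MeasurableSet {ξ | τ ξ < (4 : ℝ) ^ a} := fun a =>
    measurableSet_lt hτ measurable_const
  have hFm : AEMeasurable (fun ξ => ‖F ξ‖ₑ ^ 2) volume :=
    (Lp.aestronglyMeasurable F).enorm.pow_const 2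
  -- The upper edge of the bin gives v < 4 s 4^a; enlarging the bin to the whole space then allows
  -- Plancherel.
  have h1 : ∀ a : ℤ, ∫⁻ x in levelBin v s a, ENNReal.ofReal (v x) *
      ‖(𝓕⁻ (indicatorL2 (hS a).compl F) : L2Space d) x‖ₑ ^ 2 ≤
      ENNReal.ofReal (4 * s) * ∫⁻ ξ, (if (4 : ℝ) ^ a ≤ τ ξ then ENNReal.ofReal ((4 : ℝ) ^ a) else 0)
        * ‖F ξ‖ₑ ^ 2 := by
    intro a
    calc ∫⁻ x in levelBin v s a, ENNReal.ofReal (v x) *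
          ‖(𝓕⁻ (indicatorL2 (hS a).compl F) : L2Space d) x‖ₑ ^ 2
        ≤ ∫⁻ x in levelBin v s a, ENNReal.ofReal (4 * s * (4 : ℝ) ^ a) *
          ‖(𝓕⁻ (indicatorL2 (hS a).compl F) : L2Space d) x‖ₑ ^ 2 := by
          refine setLIntegral_mono' (measurableSet_levelBin hv s a) fun x hx => ?_
          gcongr
          have := hx.2
          rw [zpow_add_one₀ (by norm_num)] at this
          linarith
      _ ≤ ∫⁻ x, ENNReal.ofReal (4 * s * (4 : ℝ) ^ a) *
          ‖(𝓕⁻ (indicatorL2 (hS a).compl F) : L2Space d) x‖ₑ ^ 2 := setLIntegral_le_lintegral _ _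
      _ = ENNReal.ofReal (4 * s) * (ENNReal.ofReal ((4 : ℝ) ^ a) *
          ∫⁻ ξ in {ξ | τ ξ < (4 : ℝ) ^ a}ᶜ, ‖F ξ‖ₑ ^ 2) := by
          rw [lintegral_const_mul' _ _ ENNReal.ofReal_ne_top,
            lintegral_enorm_sq_fourierInv_indicatorL2, ENNReal.ofReal_mul (by positivity), mul_assoc]
      _ = _ := by
          rw [← lintegral_const_mul' _ _ ENNReal.ofReal_ne_top,
            ← lintegral_indicator (hS a).compl]
          congr 2
          ext ξ
          by_cases h : (4 : ℝ) ^ a ≤ τ ξ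
          · rw [Set.indicator_of_mem (by simpa using h), if_pos h]
          · rw [Set.indicator_of_notMem (by simpa using h), if_neg h, zero_mul]
  refine (ENNReal.tsum_le_tsum h1).trans ?_
  rw [ENNReal.tsum_mul_left, ← lintegral_tsum fun a => ?_]
  · calc ENNReal.ofReal (4 * s) * ∫⁻ ξ, ∑' a : ℤ,
          (if (4 : ℝ) ^ a ≤ τ ξ then ENNReal.ofReal ((4 : ℝ) ^ a) else 0) * ‖F ξ‖ₑ ^ 2
        ≤ ENNReal.ofReal (4 * s) * ∫⁻ ξ, ENNReal.ofReal 4 *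
          (ENNReal.ofReal (τ ξ) * ‖F ξ‖ₑ ^ 2) := by
          -- At a fixed frequency only the cut-offs with 4^a ≤ τ contribute, and their weights sum
          -- to at most 4 τ.
          refine mul_le_mul' le_rfl (lintegral_mono_ae ?_)
          filter_upwards [hpos] with ξ hξ
          rw [ENNReal.tsum_mul_right, ← mul_assoc, ← ENNReal.ofReal_mul (by norm_num)]
          gcongr
          exact tsum_zpow_indicator_le hξ
      _ = _ := by
          rw [lintegral_const_mul' _ _ ENNReal.ofReal_ne_top, ← mul_assoc,
            ← ENNReal.ofReal_mul (by positivity)]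
          congr 2
          ring
  · exact ((Measurable.ite (measurableSet_le measurable_const hτ) measurable_const
      measurable_const).aemeasurable).mul hFm

/-! ### The Cwikel-type inequality -/

/-- Phase-space bound on the number of functions that are orthonormal for the kinetic energy and on
which the potential `v` has expectation at least `1`. -/
theorem card_mul_le_lintegral_of_one_le {d : ℕ} {τ v : EuclideanSpace ℝ (Fin d) → ℝ}
    (hτ : Measurable τ) (hpos : ∀ᵐ ξ, 0 < τ ξ) (hv : Measurable v)
    (hvol : ∀ t : ℝ, 0 < t → volume {ξ | τ ξ < t} ≠ ⊤)
    (hfin : ∀ t : ℝ, 0 < t → ∫⁻ ξ in {ξ | τ ξ < t}, ENNReal.ofReal (τ ξ)⁻¹ ≠ ⊤)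
    {α : ℝ} (hα : 0 < α) (hα4 : α < 1 / 4)
    {n : ℕ} {u ψ : Fin n → L2Space d} (hu : Orthonormal ℂ u)
    (huψ : ∀ j, u j =ᵐ[volume] fun ξ => (√(τ ξ) : ℂ) * (𝓕 (ψ j) : L2Space d) ξ)
    (hone : ∀ j, 1 ≤ ∫⁻ x, ENNReal.ofReal (v x) * ‖ψ j x‖ₑ ^ 2) :
    (n : ℝ≥0∞) * ENNReal.ofReal ((1 - 4 * α) ^ 2) ≤
      ∫⁻ x, ENNReal.ofReal (v x) *
        ∫⁻ ξ in {ξ | τ ξ < v x / α ^ 2}, ENNReal.ofReal (τ ξ)⁻¹ := by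
  have hS : ∀ a : ℤ, MeasurableSet {ξ | τ ξ < (4 : ℝ) ^ a} := fun a =>
    measurableSet_lt hτ measurable_const
  have hs : 0 < α ^ 2 := by positivity
  set H : ℤ → Fin n → L2Space d := fun a j => 𝓕⁻ (indicatorL2 (hS a) (𝓕 (ψ j))) with hH
  set B : ℤ → Fin n → L2Space d := fun a j => 𝓕⁻ (indicatorL2 (hS a).compl (𝓕 (ψ j))) with hB
  have hsum : ∀ a j, H a j + B a j = ψ j := fun a j => by
    rw [hH, hB]
    simp only
    rw [← FourierTransform.fourierInv_add, indicatorL2_add_compl,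
      FourierTransform.fourierInv_fourier_eq]
  have hβ : 0 < 1 - 4 * α := by linarith
  -- Convexity of the square with weights 1 - 4α and 4α. The second weight is the square root of the
  -- high-energy bound 16 α².
  have hsplit : ∀ a j, ∀ᵐ x, ‖ψ j x‖ₑ ^ 2 ≤ ENNReal.ofReal (1 - 4 * α)⁻¹ * ‖H a j x‖ₑ ^ 2 +
      ENNReal.ofReal (4 * α)⁻¹ * ‖B a j x‖ₑ ^ 2 := by
    intro a j
    filter_upwards [Lp.coeFn_add (H a j) (B a j)] with x hx
    rw [hsum, Pi.add_apply] at hx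
    rw [hx]
    simp only [← ofReal_norm, ← ENNReal.ofReal_pow (norm_nonneg _)]
    rw [← ENNReal.ofReal_mul (by positivity), ← ENNReal.ofReal_mul (by positivity),
      ← ENNReal.ofReal_add (by positivity) (by positivity)]
    refine ENNReal.ofReal_le_ofReal ?_
    have h1 : ‖H a j x + B a j x‖ ^ 2 ≤ (‖H a j x‖ + ‖B a j x‖) ^ 2 := by
      gcongr
      exact norm_add_le _ _
    refine h1.trans ?_
    set p := ‖H a j x‖
    set q := ‖B a j x‖
    have h2 : (1 - 4 * α)⁻¹ * p ^ 2 + (4 * α)⁻¹ * q ^ 2 - (p + q) ^ 2 =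
        (4 * α * p - (1 - 4 * α) * q) ^ 2 / ((1 - 4 * α) * (4 * α)) := by
      field_simp
      ring
    have h3 : 0 ≤ (4 * α * p - (1 - 4 * α) * q) ^ 2 / ((1 - 4 * α) * (4 * α)) := by positivity
    linarith
  have hkin : ∀ j, ∫⁻ ξ, ENNReal.ofReal (τ ξ) * ‖(𝓕 (ψ j) : L2Space d) ξ‖ₑ ^ 2 = 1 := by
    intro j
    have h1 := lintegral_enorm_sq_eq (u j)
    rw [hu.1 j] at h1
    simp only [one_pow, ENNReal.ofReal_one] at h1
    rw [← h1]
    refine lintegral_congr_ae ?_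
    filter_upwards [huψ j, hpos] with ξ h2 h3
    rw [h2, enorm_mul, mul_pow, ← ofReal_norm (√(τ ξ) : ℂ), ← ENNReal.ofReal_pow (norm_nonneg _),
      Complex.norm_real, Real.norm_eq_abs, sq_abs, Real.sq_sqrt h3.le]
  have hmeas : ∀ f : L2Space d, AEMeasurable (fun x => ENNReal.ofReal (v x) * ‖f x‖ₑ ^ 2) volume :=
    fun f => hv.ennreal_ofReal.aemeasurable.mul ((Lp.aestronglyMeasurable f).enorm.pow_const 2)
  have hlow : ∀ j, ENNReal.ofReal ((1 - 4 * α) ^ 2) ≤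
      ∑' a : ℤ, ∫⁻ x in levelBin v (α ^ 2) a, ENNReal.ofReal (v x) * ‖H a j x‖ₑ ^ 2 := by
    intro j
    have h1 : (1 : ℝ≥0∞) ≤ ENNReal.ofReal (1 - 4 * α)⁻¹ *
        (∑' a : ℤ, ∫⁻ x in levelBin v (α ^ 2) a, ENNReal.ofReal (v x) * ‖H a j x‖ₑ ^ 2) +
        ENNReal.ofReal (4 * α) := by
      calc (1 : ℝ≥0∞) ≤ ∫⁻ x, ENNReal.ofReal (v x) * ‖ψ j x‖ₑ ^ 2 := hone j
        _ = ∑' a : ℤ, ∫⁻ x in levelBin v (α ^ 2) a, ENNReal.ofReal (v x) * ‖ψ j x‖ₑ ^ 2 :=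
          (tsum_setLIntegral_levelBin hv hs _).symm
        _ ≤ ∑' a : ℤ, (ENNReal.ofReal (1 - 4 * α)⁻¹ *
              (∫⁻ x in levelBin v (α ^ 2) a, ENNReal.ofReal (v x) * ‖H a j x‖ₑ ^ 2) +
            ENNReal.ofReal (4 * α)⁻¹ *
              ∫⁻ x in levelBin v (α ^ 2) a, ENNReal.ofReal (v x) * ‖B a j x‖ₑ ^ 2) := by
          refine ENNReal.tsum_le_tsum fun a => ?_
          rw [← lintegral_const_mul' _ _ ENNReal.ofReal_ne_top,
            ← lintegral_const_mul' _ _ ENNReal.ofReal_ne_top,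
            ← lintegral_add_left' ((hmeas _).restrict.const_mul _)]
          refine lintegral_mono_ae ?_
          filter_upwards [ae_restrict_of_ae (hsplit a j)] with x hx
          refine (mul_le_mul' le_rfl hx).trans (le_of_eq ?_)
          ring
        _ = ENNReal.ofReal (1 - 4 * α)⁻¹ *
              (∑' a : ℤ, ∫⁻ x in levelBin v (α ^ 2) a, ENNReal.ofReal (v x) * ‖H a j x‖ₑ ^ 2) +
            ENNReal.ofReal (4 * α)⁻¹ *
              ∑' a : ℤ, ∫⁻ x in levelBin v (α ^ 2) a, ENNReal.ofReal (v x) * ‖B a j x‖ₑ ^ 2 := by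
          rw [ENNReal.tsum_add, ENNReal.tsum_mul_left, ENNReal.tsum_mul_left]
        _ ≤ _ := by
          gcongr
          have h2 := tsum_levelBin_fourierInv_high_le hτ hpos hv hs (𝓕 (ψ j))
          rw [hkin j, mul_one] at h2
          -- The high parts contribute (4α)⁻¹ · 16 α² = 4α, which leaves 1 - 4α for the low parts.
          calc _ ≤ ENNReal.ofReal (4 * α)⁻¹ * ENNReal.ofReal (16 * α ^ 2) := by gcongr
            _ = _ := by
              rw [← ENNReal.ofReal_mul (by positivity)]
              congr 1
              field_simp
              ring
    set A := ∑' a : ℤ, ∫⁻ x in levelBin v (α ^ 2) a, ENNReal.ofReal (v x) * ‖H a j x‖ₑ ^ 2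
    have h3 : ENNReal.ofReal (1 - 4 * α) ≤ ENNReal.ofReal (1 - 4 * α)⁻¹ * A := by
      rw [ENNReal.ofReal_sub _ (by positivity), ENNReal.ofReal_one]
      exact tsub_le_iff_right.mpr h1
    calc ENNReal.ofReal ((1 - 4 * α) ^ 2)
        = ENNReal.ofReal (1 - 4 * α) * ENNReal.ofReal (1 - 4 * α) := by
          rw [← ENNReal.ofReal_mul hβ.le, sq]
      _ ≤ ENNReal.ofReal (1 - 4 * α) * (ENNReal.ofReal (1 - 4 * α)⁻¹ * A) := by gcongr
      _ = A := by
          rw [← mul_assoc, ← ENNReal.ofReal_mul hβ.le, mul_inv_cancel₀ hβ.ne', ENNReal.ofReal_one,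
            one_mul]
  calc (n : ℝ≥0∞) * ENNReal.ofReal ((1 - 4 * α) ^ 2)
      = ∑ _j : Fin n, ENNReal.ofReal ((1 - 4 * α) ^ 2) := by simp
    _ ≤ ∑ j, ∑' a : ℤ, ∫⁻ x in levelBin v (α ^ 2) a, ENNReal.ofReal (v x) * ‖H a j x‖ₑ ^ 2 :=
      Finset.sum_le_sum fun j _ => hlow j
    _ = ∑' a : ℤ, ∑ j, ∫⁻ x in levelBin v (α ^ 2) a, ENNReal.ofReal (v x) * ‖H a j x‖ₑ ^ 2 :=
      (Summable.tsum_finsetSum fun _ _ => ENNReal.summable).symm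
    _ ≤ ∑' a : ℤ, ∫⁻ x in levelBin v (α ^ 2) a, ENNReal.ofReal (v x) *
        ∫⁻ ξ in {ξ | τ ξ < v x / α ^ 2}, ENNReal.ofReal (τ ξ)⁻¹ := by
      refine ENNReal.tsum_le_tsum fun a => ?_
      rw [← lintegral_finsetSum' _ fun j _ => (hmeas _).restrict]
      refine lintegral_mono_ae ?_
      have h4 : (0 : ℝ) < 4 ^ a := by positivity
      filter_upwards [ae_restrict_of_ae (sum_enorm_sq_fourierInv_low_le hτ hpos (hvol _ h4)
        (hfin _ h4) hu huψ), ae_restrict_mem (measurableSet_levelBin hv (α ^ 2) a)] with x h5 h6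
      rw [← Finset.mul_sum]
      gcongr
      -- The lower edge of the bin gives 4^a ≤ v/α², so the cut-off region lies in {τ < v/α²}.
      refine h5.trans (lintegral_mono_set fun ξ hξ => ?_)
      refine lt_of_lt_of_le (show τ ξ < (4 : ℝ) ^ a from hξ) ?_
      rw [le_div_iff₀ hs, mul_comm]
      exact h6.1
    _ = _ := tsum_setLIntegral_levelBin hv hs _

/-! ### From negative eigenvalues to kinetically orthonormal functions -/

theorem conj_schrodingerForm {d : ℕ} (T V : EuclideanSpace ℝ (Fin d) → ℝ) (φ ψ : L2Space d) :
    conj (schrodingerForm T V φ ψ) = schrodingerForm T V ψ φ := by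
  unfold schrodingerForm
  rw [map_add, ← integral_conj, ← integral_conj]
  congr 1
  · refine integral_congr_ae (Filter.Eventually.of_forall fun x => ?_)
    simp only [map_mul, Complex.conj_conj, Complex.conj_ofReal]
    ring
  · refine integral_congr_ae (Filter.Eventually.of_forall fun x => ?_)
    simp only [map_mul, Complex.conj_conj, Complex.conj_ofReal]
    ring

theorem mem_schrodingerEigenspace {d : ℕ} {T V : EuclideanSpace ℝ (Fin d) → ℝ}
    {hV : AEMeasurable V volume} {E : ℝ} {ψ : L2Space d} :
    ψ ∈ schrodingerEigenspace T V hV E ↔ (ψ, (E : ℂ) • ψ) ∈ schrodingerGraph T V hV :=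
  Iff.rfl

theorem mem_schrodingerGraph {d : ℕ} {T V : EuclideanSpace ℝ (Fin d) → ℝ}
    {hV : AEMeasurable V volume} {ψ χ : L2Space d} :
    (ψ, χ) ∈ schrodingerGraph T V hV ↔ ψ ∈ schrodingerFormDomain T V ∧
      ∀ φ ∈ schrodingerFormDomain T V, schrodingerForm T V φ ψ = inner ℂ φ χ :=
  Iff.rfl

/-- Eigenfunctions for different eigenvalues are orthogonal. -/
theorem inner_eq_zero_of_mem_schrodingerEigenspace {d : ℕ} {T V : EuclideanSpace ℝ (Fin d) → ℝ}
    {hV : AEMeasurable V volume} {E E' : ℝ} (hE : E ≠ E') {φ ψ : L2Space d}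
    (hφ : φ ∈ schrodingerEigenspace T V hV E) (hψ : ψ ∈ schrodingerEigenspace T V hV E') :
    inner ℂ φ ψ = 0 := by
  rw [mem_schrodingerEigenspace, mem_schrodingerGraph] at hφ hψ
  have h1 := hψ.2 φ hφ.1
  have h2 := hφ.2 ψ hψ.1
  rw [← conj_schrodingerForm, h1, inner_smul_right, inner_smul_right, map_mul,
    Complex.conj_ofReal, inner_conj_symm] at h2
  have h3 : ((E' : ℂ) - E) * inner ℂ ψ φ = 0 := by rw [sub_mul, h2, sub_self]
  have h4 : ((E' : ℂ) - E) ≠ 0 := sub_ne_zero.mpr (by exact_mod_cast hE.symm)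
  rw [← inner_conj_symm, (mul_eq_zero.mp h3).resolve_left h4, map_zero]

/-- A subspace of dimension at least `n` contains `n` orthonormal vectors. -/
theorem exists_orthonormal_of_le_rank {H : Type*} [NormedAddCommGroup H] [InnerProductSpace ℂ H]
    (U : Submodule ℂ H) {n : ℕ} (hn : (n : Cardinal) ≤ Module.rank ℂ U) :
    ∃ v : Fin n → H, Orthonormal ℂ v ∧ ∀ i, v i ∈ U := by
  obtain ⟨s, hs, hli⟩ := exists_finset_linearIndependent_of_le_rank hn
  set W : Submodule ℂ U := Submodule.span ℂ (s : Set U) with hW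
  have hfd : FiniteDimensional ℂ W := FiniteDimensional.span_finset ℂ s
  have hdim : Module.finrank ℂ W = n := by
    rw [hW, finrank_span_finset_eq_card hli, hs]
  let b := (stdOrthonormalBasis ℂ W).reindex (finCongr hdim)
  exact ⟨fun i => ((b i : W) : U), ((b.orthonormal.comp_linearIsometry W.subtypeₗᵢ).comp_linearIsometry
    U.subtypeₗᵢ), fun i => ((b i : W) : U).2⟩

/-- Reduces possibly infinite multiplicities to finite families: an infinite r i admits arbitrarily
large n i and so forces C = ∞. -/
theorem sum_toENNReal_le_of_forall_nat_le {ι : Type*} (s : Finset ι) (r : ι → ℕ∞) (C : ℝ≥0∞)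
    (h : ∀ n : ι → ℕ, (∀ i, (n i : ℕ∞) ≤ r i) → ((∑ i ∈ s, n i : ℕ) : ℝ≥0∞) ≤ C) :
    ∑ i ∈ s, ((r i : ℕ∞) : ℝ≥0∞) ≤ C := by
  classical
  by_cases htop : ∃ i ∈ s, r i = ⊤
  · obtain ⟨i, his, hi⟩ := htop
    have hC : C = ⊤ := by
      refine ENNReal.eq_top_of_forall_nnreal_le fun x => ?_
      obtain ⟨N, hN⟩ := exists_nat_ge x
      refine le_trans ?_ (h (fun j => if j = i then N else 0) fun j => ?_)
      · rw [Finset.sum_ite_eq' s i, if_pos his]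
        exact_mod_cast hN
      · by_cases hj : j = i
        · rw [hj, hi]
          exact le_top
        · simp [hj]
    rw [hC]
    exact le_top
  · push Not at htop
    have h1 := h (fun i => (r i).toNat) fun i => ENat.natCast_toNat_le_self _
    refine le_trans (le_of_eq ?_) h1
    push_cast
    refine Finset.sum_congr rfl fun i hi => ?_
    conv_lhs => rw [← ENat.natCast_toNat (htop i hi)]
    simp

/-- A bound on the size of orthonormal families of eigenfunctions for negative eigenvalues bounds
the number of negative eigenvalues. -/
theorem negativeEigenvalueCount_le_of_forall_orthonormal {d : ℕ}
    {T V : EuclideanSpace ℝ (Fin d) → ℝ} {hV : AEMeasurable V volume} {C : ℝ≥0∞}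
    (h : ∀ (n : ℕ) (v : Fin n → L2Space d) (E : Fin n → ℝ), Orthonormal ℂ v → (∀ i, E i < 0) →
      (∀ i, v i ∈ schrodingerEigenspace T V hV (E i)) → (n : ℝ≥0∞) ≤ C) :
    negativeEigenvalueCount T V hV ≤ C := by
  classical
  unfold negativeEigenvalueCount
  rw [ENNReal.tsum_eq_iSup_sum]
  refine iSup_le fun s => sum_toENNReal_le_of_forall_nat_le s _ C fun n hn => ?_
  have hex : ∀ E : Set.Iio (0 : ℝ), ∃ v : Fin (n E) → L2Space d, Orthonormal ℂ v ∧
      ∀ i, v i ∈ schrodingerEigenspace T V hV E := fun E =>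
    exists_orthonormal_of_le_rank _ (Cardinal.natCast_le_toENat.mp (hn E))
  choose v hvo hv using hex
  -- The orthonormal families of the chosen eigenspaces are merged into one, since distinct
  -- eigenspaces are orthogonal.
  let ι := Σ E : s, Fin (n E)
  let e : Fin (∑ E ∈ s, n E) ≃ ι := (finCongr (by simp [ι, Finset.sum_attach s n])).trans
    (Fintype.equivFin ι).symm
  have ho : Orthonormal ℂ fun p : ι => v p.1 p.2 := by
    refine ⟨fun p => (hvo p.1).1 p.2, ?_⟩
    rintro ⟨E, i⟩ ⟨E', j⟩ hne
    by_cases hE : E = E'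
    · subst hE
      exact (hvo E).2 fun hij => hne (congrArg (Sigma.mk E) hij)
    · exact inner_eq_zero_of_mem_schrodingerEigenspace
        (fun h' => hE (Subtype.ext (Subtype.ext h'))) (hv E i) (hv E' j)
  exact h _ (fun k => v (e k).1 (e k).2) (fun k => (e k).1) (ho.comp e e.injective)
    (fun k => (e k).1.1.2) (fun k => hv _ _)

theorem coeFn_mulOperator {d : ℕ} {m : EuclideanSpace ℝ (Fin d) → ℝ} (f : mulDomain m) :
    (mulOperator m).toFun f =ᵐ[volume] fun x => (m x : ℂ) * (f : L2Space d) x :=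
  (mem_mulDomain.mp f.2).coeFn_toLp

theorem ofReal_integral_le_lintegral_ofReal {X : Type*} [MeasurableSpace X] {μ : Measure X}
    {f : X → ℝ} (hf : Integrable f μ) :
    ENNReal.ofReal (∫ x, f x ∂μ) ≤ ∫⁻ x, ENNReal.ofReal (f x) ∂μ := by
  rw [integral_eq_lintegral_pos_part_sub_lintegral_neg_part hf]
  refine (ENNReal.ofReal_le_ofReal (sub_le_self _ ENNReal.toReal_nonneg)).trans ?_
  exact ENNReal.ofReal_toReal_le

/-- A form domain function of unit kinetic energy and nonpositive total energy feels the negative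
part of the potential with expectation at least `1`. -/
theorem one_le_lintegral_negPart_mul {d : ℕ} {T V : EuclideanSpace ℝ (Fin d) → ℝ}
    (hV : AEMeasurable V volume) {u ψ : L2Space d} (hu : ‖u‖ = 1)
    (huψ : u =ᵐ[volume] fun ξ => (√(T ((2 * Real.pi) • ξ)) : ℂ) * (𝓕 ψ : L2Space d) ξ)
    (hψ : ψ ∈ potentialFormDomain V) (hneg : (schrodingerForm T V ψ ψ).re ≤ 0) :
    1 ≤ ∫⁻ x, ENNReal.ofReal (max 0 (-V x)) * ‖ψ x‖ₑ ^ 2 := by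
  have hint := schrodingerForm_integrable_potential hV hψ hψ
  have hpot : ∀ x, (V x : ℂ) * (conj (ψ x) * ψ x) = ((V x * ‖ψ x‖ ^ 2 : ℝ) : ℂ) := fun x => by
    rw [Complex.conj_mul']
    push_cast
    rfl
  simp only [hpot] at hint
  have hint' : Integrable (fun x => V x * ‖ψ x‖ ^ 2) volume := hint.re
  have hkin : (∫ ξ, conj ((√(T ((2 * Real.pi) • ξ)) : ℂ) * (𝓕 ψ : L2Space d) ξ) *
      ((√(T ((2 * Real.pi) • ξ)) : ℂ) * (𝓕 ψ : L2Space d) ξ)) = 1 := by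
    have h1 : inner ℂ u u = (1 : ℂ) := by rw [inner_self_eq_norm_sq_to_K, hu]; simp
    rw [← h1, L2.inner_def]
    refine integral_congr_ae ?_
    filter_upwards [huψ] with ξ hξ
    rw [hξ, RCLike.inner_apply, mul_comm]
  unfold schrodingerForm at hneg
  simp only [hpot] at hneg
  rw [hkin, integral_complex_ofReal, Complex.add_re, Complex.one_re] at hneg
  have h2 : 1 ≤ ∫ x, -(V x * ‖ψ x‖ ^ 2) := by
    rw [integral_neg]
    rw [Complex.ofReal_re] at hneg
    linarith
  calc (1 : ℝ≥0∞) ≤ ENNReal.ofReal (∫ x, -(V x * ‖ψ x‖ ^ 2)) := by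
        rw [← ENNReal.ofReal_one]
        exact ENNReal.ofReal_le_ofReal h2
    _ ≤ ∫⁻ x, ENNReal.ofReal (-(V x * ‖ψ x‖ ^ 2)) := ofReal_integral_le_lintegral_ofReal hint'.neg
    _ ≤ _ := by
        refine lintegral_mono fun x => ?_
        rw [← ofReal_norm, ← ENNReal.ofReal_pow (norm_nonneg _),
          ← ENNReal.ofReal_mul (le_max_left _ _), ← neg_mul]
        apply ENNReal.ofReal_le_ofReal
        gcongr
        exact le_max_right _ _

/-- From orthonormal eigenfunctions for nonpositive eigenvalues one obtains as many functions that
are orthonormal for the kinetic energy and have nonpositive energy. -/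
theorem exists_kinetic_orthonormal {d : ℕ} {T V : EuclideanSpace ℝ (Fin d) → ℝ}
    {hV : AEMeasurable V volume} (hpos : ∀ᵐ ξ, 0 < T ((2 * Real.pi) • ξ))
    {n : ℕ} {v : Fin n → L2Space d} {E : Fin n → ℝ} (hv : Orthonormal ℂ v) (hE : ∀ i, E i ≤ 0)
    (hmem : ∀ i, v i ∈ schrodingerEigenspace T V hV (E i)) :
    ∃ u ψ : Fin n → L2Space d, Orthonormal ℂ u ∧
      (∀ j, u j =ᵐ[volume] fun ξ =>
        (√(T ((2 * Real.pi) • ξ)) : ℂ) * (𝓕 (ψ j) : L2Space d) ξ) ∧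
      ∀ j, ψ j ∈ potentialFormDomain V ∧ (schrodingerForm T V (ψ j) (ψ j)).re ≤ 0 := by
  set m : EuclideanSpace ℝ (Fin d) → ℝ := fun ξ => √(T ((2 * Real.pi) • ξ)) with hm
  have hgr := fun i => mem_schrodingerGraph.mp (mem_schrodingerEigenspace.mp (hmem i))
  have hdom : ∀ i, (𝓕 (v i) : L2Space d) ∈ mulDomain m := fun i => (hgr i).1.1
  let A : mulDomain m →ₗ[ℂ] L2Space d := (mulOperator m).toFun
  set w : Fin n → L2Space d := fun i => A ⟨𝓕 (v i), hdom i⟩ with hw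
  have hcomb : ∀ c : Fin n → ℂ, ((∑ i, c i • w i : L2Space d)) =ᵐ[volume] fun ξ =>
      (m ξ : ℂ) * (𝓕 (∑ i, c i • v i : L2Space d) : L2Space d) ξ := by
    intro c
    set f : mulDomain m := ∑ i, c i • (⟨𝓕 (v i), hdom i⟩ : mulDomain m) with hf
    have h1 : (∑ i, c i • w i) = A f := by
      rw [hf, map_sum]
      simp only [map_smul, hw]
    have h2 : (f : L2Space d) = 𝓕 (∑ i, c i • v i : L2Space d) := by
      have h3 : (𝓕 (∑ i, c i • v i : L2Space d) : L2Space d) = ∑ i, c i • (𝓕 (v i) : L2Space d) := by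
        have := map_sum (Lp.fourierTransformₗᵢ (EuclideanSpace ℝ (Fin d)) ℂ)
          (fun i => c i • v i) Finset.univ
        simp only [map_smul] at this
        exact this
      rw [h3, hf]
      simp
    rw [h1, ← h2]
    exact coeFn_mulOperator f
  -- Multiplication by √T is injective because T > 0 almost everywhere, and 𝓕 is unitary.
  have hli : LinearIndependent ℂ w := by
    rw [Fintype.linearIndependent_iff]
    intro c hc
    have h1 : (𝓕 (∑ i, c i • v i : L2Space d) : L2Space d) = 0 := by
      apply Lp.ext
      filter_upwards [hcomb c, hpos, Lp.coeFn_zero ℂ 2 (volume : Measure (EuclideanSpace ℝ (Fin d)))]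
        with ξ h2 h3 h4
      rw [hc, h4, Pi.zero_apply] at h2
      rw [h4, Pi.zero_apply]
      refine (mul_eq_zero.mp h2.symm).resolve_left ?_
      exact_mod_cast (Real.sqrt_pos.mpr h3).ne'
    have h2 : (∑ i, c i • v i : L2Space d) = 0 :=
      (Lp.fourierTransformₗᵢ (EuclideanSpace ℝ (Fin d)) ℂ).map_eq_zero_iff.mp h1
    exact Fintype.linearIndependent_iff.mp hv.linearIndependent c h2
  set W : Submodule ℂ (L2Space d) := Submodule.span ℂ (Set.range w) with hW
  have hfd : FiniteDimensional ℂ W := FiniteDimensional.span_of_finite ℂ (Set.finite_range w)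
  have hdim : Module.finrank ℂ W = n := by
    rw [hW, finrank_span_eq_card hli, Fintype.card_fin]
  let b := (stdOrthonormalBasis ℂ W).reindex (finCongr hdim)
  have hc : ∀ j, ∃ c : Fin n → ℂ, ∑ i, c i • w i = (b j : L2Space d) := fun j =>
    (Submodule.mem_span_range_iff_exists_fun ℂ).mp (b j).2
  choose c hc using hc
  refine ⟨fun j => (b j : L2Space d), fun j => ∑ i, c j i • v i,
    b.orthonormal.comp_linearIsometry W.subtypeₗᵢ, fun j => ?_, fun j => ?_⟩
  · simp only [← hc j]
    exact hcomb (c j)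
  · have h1 : ((∑ i, c j i • v i : L2Space d), (∑ i, (c j i * E i) • v i : L2Space d)) ∈
        schrodingerGraph T V hV := by
      have h2 := Submodule.sum_mem (schrodingerGraph T V hV) (t := Finset.univ)
        (f := fun i => c j i • ((v i, (E i : ℂ) • v i) : L2Space d × L2Space d)) fun i _ =>
        Submodule.smul_mem _ _ (mem_schrodingerEigenspace.mp (hmem i))
      convert h2 using 1
      ext1
      · simp [Prod.fst_sum]
      · simp only [Prod.snd_sum, Prod.smul_snd, smul_smul]
    rw [mem_schrodingerGraph] at h1
    refine ⟨h1.1.2, ?_⟩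
    -- The orthonormal eigenfunctions diagonalize the form: its value at ψ_j is ∑ |c_i|² E_i.
    rw [h1.2 _ h1.1, hv.inner_sum, Complex.re_sum]
    refine Finset.sum_nonpos fun i _ => ?_
    have h3 : conj (c j i) * (c j i * (E i : ℂ)) = ((‖c j i‖ ^ 2 * E i : ℝ) : ℂ) := by
      rw [← mul_assoc, Complex.conj_mul']
      push_cast
      rfl
    rw [h3, Complex.ofReal_re]
    exact mul_nonpos_of_nonneg_of_nonpos (by positivity) (hE i)

/-- A Cwikel-type bound on the number of negative eigenvalues of `T(p) + V`. -/
theorem negativeEigenvalueCount_le_phaseSpace {d : ℕ} {T V : EuclideanSpace ℝ (Fin d) → ℝ}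
    (hT : Measurable T) (hV : AEMeasurable V volume) (hpos : ∀ᵐ ξ, 0 < T ((2 * Real.pi) • ξ))
    (hvol : ∀ t : ℝ, 0 < t → volume {ξ | T ((2 * Real.pi) • ξ) < t} ≠ ⊤)
    (hfin : ∀ t : ℝ, 0 < t →
      ∫⁻ ξ in {ξ | T ((2 * Real.pi) • ξ) < t}, ENNReal.ofReal (T ((2 * Real.pi) • ξ))⁻¹ ≠ ⊤)
    {α : ℝ} (hα : 0 < α) (hα4 : α < 1 / 4) :
    negativeEigenvalueCount T V hV ≤
      (∫⁻ x, ENNReal.ofReal (max 0 (-V x)) *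
        ∫⁻ ξ in {ξ | T ((2 * Real.pi) • ξ) < max 0 (-V x) / α ^ 2},
          ENNReal.ofReal (T ((2 * Real.pi) • ξ))⁻¹) / ENNReal.ofReal ((1 - 4 * α) ^ 2) := by
  have hβ : 0 < (1 - 4 * α) ^ 2 := by
    have : 0 < 1 - 4 * α := by linarith
    positivity
  refine negativeEigenvalueCount_le_of_forall_orthonormal fun n v E hv hE hmem => ?_
  rw [ENNReal.le_div_iff_mul_le (Or.inl (ENNReal.ofReal_pos.mpr hβ).ne')
    (Or.inl ENNReal.ofReal_ne_top)]
  obtain ⟨u, ψ, hu, huψ, hψ⟩ := exists_kinetic_orthonormal hpos hv (fun i => (hE i).le) hmem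
  -- The level sets need a measurable potential, so V is replaced by a measurable representative.
  have hmk : (fun x => max 0 (-V x)) =ᵐ[volume] fun x => max 0 (-(hV.mk V x)) := by
    filter_upwards [hV.ae_eq_mk] with x hx
    rw [hx]
  have h := card_mul_le_lintegral_of_one_le (τ := fun ξ => T ((2 * Real.pi) • ξ))
    (v := fun x => max 0 (-(hV.mk V x))) (hT.comp (measurable_const_smul _)) hpos
    (measurable_const.max hV.measurable_mk.neg) hvol hfin hα hα4 hu huψ fun j => ?_
  · refine h.trans (le_of_eq (lintegral_congr_ae ?_))
    filter_upwards [hmk] with x hx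
    rw [← hx]
  · refine (one_le_lintegral_negPart_mul hV (hu.1 j) (huψ j) (hψ j).1 (hψ j).2).trans
      (le_of_eq (lintegral_congr_ae ?_))
    filter_upwards [hmk] with x hx
    rw [← hx]

/-! ### Sublevel sets of the pair symbol as ellipsoids -/

/-- The right-hand side factors as (s - a - b)(s + a - b)(s - a + b)(s + a + b), where |a - b| < s
makes all factors but the first positive. -/
theorem add_lt_iff_of_abs_sub_lt {a b s : ℝ} (ha : 0 < a) (hb : 0 < b) (hs : |a - b| < s) :
    a + b < s ↔ 0 < (s ^ 2 + b ^ 2 - a ^ 2) ^ 2 - 4 * s ^ 2 * b ^ 2 := by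
  have h1 : (s ^ 2 + b ^ 2 - a ^ 2) ^ 2 - 4 * s ^ 2 * b ^ 2 =
      (s - (a + b)) * ((s + (a - b)) * ((s - (a - b)) * (s + a + b))) := by ring
  have h2 := abs_lt.mp hs
  have h3 : 0 < (s + (a - b)) * ((s - (a - b)) * (s + a + b)) := by
    have : 0 < s := (abs_nonneg _).trans_lt hs
    have h4 : 0 < s + (a - b) := by linarith
    have h5 : 0 < s - (a - b) := by linarith
    positivity
  rw [h1, mul_pos_iff_of_pos_right h3, sub_pos]

/-- By Cauchy–Schwarz the squared difference is at most ‖P‖² + (mp - mm)², which is less than ‖P‖² +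
(mp + mm)². This is what makes squaring twice reversible. -/
theorem abs_sqrt_sub_sqrt_lt {H : Type*} [NormedAddCommGroup H] [InnerProductSpace ℝ H]
    (P ζ : H) {mp mm s : ℝ} (hmp : 0 < mp) (hmm : 0 < mm) (hs : 0 ≤ s)
    (hg : ‖P‖ ^ 2 + (mp + mm) ^ 2 ≤ s ^ 2) :
    |√(‖P - ζ‖ ^ 2 + mp ^ 2) - √(‖ζ‖ ^ 2 + mm ^ 2)| < s := by
  refine abs_lt_of_sq_lt_sq ?_ hs
  have hA := Real.sq_sqrt (by positivity : 0 ≤ ‖P - ζ‖ ^ 2 + mp ^ 2)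
  have hB := Real.sq_sqrt (by positivity : 0 ≤ ‖ζ‖ ^ 2 + mm ^ 2)
  have h1 := norm_sub_sq_real P ζ
  have h2 : ‖P - ζ‖ * ‖ζ‖ + mp * mm ≤ √(‖P - ζ‖ ^ 2 + mp ^ 2) * √(‖ζ‖ ^ 2 + mm ^ 2) := by
    rw [← Real.sqrt_mul (by positivity)]
    refine Real.le_sqrt_of_sq_le ?_
    nlinarith [sq_nonneg (‖P - ζ‖ * mm - ‖ζ‖ * mp)]
  have h3 := real_inner_le_norm (P - ζ) (-ζ)
  rw [inner_neg_right, inner_sub_left, norm_neg, real_inner_self_eq_norm_sq] at h3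
  have h4 := mul_pos hmp hmm
  nlinarith

/-- The sublevel sets of the kinetic energy are ellipsoids. -/
theorem pairSymbol_lt_iff {d : ℕ} (P η : EuclideanSpace ℝ (Fin d)) {mp mm u : ℝ}
    (hmp : 0 < mp) (hmm : 0 < mm) (hu : 0 ≤ u) {s D : ℝ}
    (hs : s = u + √(‖P‖ ^ 2 + (mp + mm) ^ 2)) (hD : D = s ^ 2 - ‖P‖ ^ 2) :
    pairSymbol P mp mm η < u ↔
      s ^ 2 * ‖η + (mm / (mp + mm) - (D + mm ^ 2 - mp ^ 2) / (2 * D)) • P‖ ^ 2 -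
        inner ℝ P (η + (mm / (mp + mm) - (D + mm ^ 2 - mp ^ 2) / (2 * D)) • P) ^ 2 <
      s ^ 2 * (D - (mp + mm) ^ 2) * (D - (mm - mp) ^ 2) / (4 * D) := by
  have hM : 0 < mp + mm := by positivity
  have hg0 : 0 ≤ √(‖P‖ ^ 2 + (mp + mm) ^ 2) := Real.sqrt_nonneg _
  have hg := Real.sq_sqrt (by positivity : 0 ≤ ‖P‖ ^ 2 + (mp + mm) ^ 2)
  have hs0 : 0 ≤ s := by rw [hs]; positivity
  have hgs : ‖P‖ ^ 2 + (mp + mm) ^ 2 ≤ s ^ 2 := by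
    rw [← hg, hs]
    gcongr
    linarith
  have hDpos : 0 < D := by
    have : 0 < (mp + mm) ^ 2 := by positivity
    linarith
  set ζ := η + (mm / (mp + mm)) • P with hζ
  -- The point κ P is the centre of the ellipsoid in the variable ζ, found by completing the square.
  set κ := (D + mm ^ 2 - mp ^ 2) / (2 * D) with hκ
  have h1 : (mp / (mp + mm)) • P - η = P - ζ := by
    have : mp / (mp + mm) = 1 - mm / (mp + mm) := by field_simp; ring
    rw [this, hζ, sub_smul, one_smul]
    abel
  have h2 : (mm / (mp + mm)) • P + η = ζ := add_comm _ _
  have h3 : η + (mm / (mp + mm) - κ) • P = ζ - κ • P := by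
    rw [hζ, sub_smul]
    abel
  have h4 : ∀ m : ℝ, (m / (mp + mm)) ^ 2 * (mp + mm) ^ 2 = m ^ 2 := fun m => by
    field_simp
  have hbd := abs_sqrt_sub_sqrt_lt P ζ hmp hmm hs0 hgs
  have hA : 0 < √(‖P - ζ‖ ^ 2 + mp ^ 2) := Real.sqrt_pos.mpr (by positivity)
  have hB : 0 < √(‖ζ‖ ^ 2 + mm ^ 2) := Real.sqrt_pos.mpr (by positivity)
  unfold pairSymbol
  rw [h1, h2, h3, h4, h4, sub_lt_iff_lt_add, ← hs, add_lt_iff_of_abs_sub_lt hA hB hbd,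
    Real.sq_sqrt (by positivity), Real.sq_sqrt (by positivity), ← sub_pos (a := _ / _)]
  have h5 : ‖P - ζ‖ ^ 2 = ‖P‖ ^ 2 - 2 * inner ℝ P ζ + ‖ζ‖ ^ 2 := norm_sub_sq_real P ζ
  have h6 : ‖ζ - κ • P‖ ^ 2 = ‖ζ‖ ^ 2 - 2 * κ * inner ℝ P ζ + κ ^ 2 * ‖P‖ ^ 2 := by
    rw [norm_sub_sq_real, inner_smul_right, norm_smul, mul_pow, Real.norm_eq_abs, sq_abs,
      real_inner_comm]
    ring
  have h7 : inner ℝ P (ζ - κ • P) = inner ℝ P ζ - κ * ‖P‖ ^ 2 := by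
    rw [inner_sub_right, inner_smul_right, real_inner_self_eq_norm_sq]
  rw [h5, h6, h7]
  have hp : ‖P‖ ^ 2 = s ^ 2 - D := by linarith
  -- The difference of the two squared roots is affine in ζ, so the apparent quartic is quadratic.
  have h8 : s ^ 2 * (D - (mp + mm) ^ 2) * (D - (mm - mp) ^ 2) / (4 * D) -
      (s ^ 2 * (‖ζ‖ ^ 2 - 2 * κ * inner ℝ P ζ + κ ^ 2 * ‖P‖ ^ 2) -
        (inner ℝ P ζ - κ * ‖P‖ ^ 2) ^ 2) =
      ((s ^ 2 + (‖ζ‖ ^ 2 + mm ^ 2) - (‖P‖ ^ 2 - 2 * inner ℝ P ζ + ‖ζ‖ ^ 2 + mp ^ 2)) ^ 2 -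
        4 * s ^ 2 * (‖ζ‖ ^ 2 + mm ^ 2)) / 4 := by
    rw [hp, hκ]
    field_simp
    ring
  rw [h8]
  constructor <;> intro h <;> linarith

/-- The volume of the ellipsoid `s² ‖ξ‖² - ⟪P, ξ⟫² < R`. -/
theorem volume_ellipsoid {d : ℕ} (hd : 0 < d) (P : EuclideanSpace ℝ (Fin d)) {s R : ℝ}
    (hs : 0 < s) (hD : 0 < s ^ 2 - ‖P‖ ^ 2) :
    volume {ξ : EuclideanSpace ℝ (Fin d) | s ^ 2 * ‖ξ‖ ^ 2 - inner ℝ P ξ ^ 2 < R} =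
      ENNReal.ofReal ((s ^ d * (√(s ^ 2 - ‖P‖ ^ 2) / s))⁻¹ * √R ^ d) *
        volume (Metric.ball (0 : EuclideanSpace ℝ (Fin d)) 1) := by
  have : Nonempty (Fin d) := ⟨⟨0, hd⟩⟩
  set r := √(s ^ 2 - ‖P‖ ^ 2) with hr
  have hr0 : 0 < r := Real.sqrt_pos.mpr hD
  have hr2 : r ^ 2 = s ^ 2 - ‖P‖ ^ 2 := Real.sq_sqrt hD.le
  -- S = s - κ P ⊗ P is to be the positive square root of s² - P ⊗ P, with eigenvalue r along P and
  -- s across it. This value equals (s - r)/‖P‖² and also makes sense at P = 0.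
  set κ := (s + r)⁻¹ with hκ
  have hκ1 : κ * (s + r) = 1 := inv_mul_cancel₀ (by positivity)
  have hκP : κ * ‖P‖ ^ 2 = s - r := by
    have : ‖P‖ ^ 2 = (s - r) * (s + r) := by linarith
    rw [this, mul_left_comm, hκ1, mul_one]
  set f : Module.Dual ℝ (EuclideanSpace ℝ (Fin d)) := (-(κ / s)) • innerₗ _ P with hf
  set S : EuclideanSpace ℝ (Fin d) →ₗ[ℝ] EuclideanSpace ℝ (Fin d) :=
    s • LinearMap.transvection f P with hS
  have hdet : LinearMap.det S = s ^ d * (r / s) := by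
    rw [hS, LinearMap.det_smul, LinearMap.transvection.det, finrank_euclideanSpace_fin]
    congr 1
    have h1 : f P = -(κ / s) * ‖P‖ ^ 2 := by
      simp [hf]
    rw [h1]
    field_simp
    linarith
  have hdet0 : 0 < LinearMap.det S := by rw [hdet]; positivity
  have hSx : ∀ ξ, S ξ = s • ξ - (κ * inner ℝ P ξ) • P := by
    intro ξ
    rw [hS, LinearMap.smul_apply, LinearMap.transvection.apply, smul_add, smul_smul, hf,
      LinearMap.smul_apply, innerₗ_apply_apply, smul_eq_mul, sub_eq_add_neg, ← neg_smul]
    congr 2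
    field_simp
  have hset : {ξ : EuclideanSpace ℝ (Fin d) | s ^ 2 * ‖ξ‖ ^ 2 - inner ℝ P ξ ^ 2 < R} =
      S ⁻¹' Metric.ball 0 (√R) := by
    ext ξ
    have h1 : s ^ 2 * ‖ξ‖ ^ 2 - inner ℝ P ξ ^ 2 = ‖S ξ‖ ^ 2 := by
      rw [hSx, norm_sub_sq_real, inner_smul_left, inner_smul_right, norm_smul, norm_smul, mul_pow,
        mul_pow, Real.norm_eq_abs, Real.norm_eq_abs, sq_abs, sq_abs, mul_pow, real_inner_comm P ξ]
      simp only [conj_trivial]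
      linear_combination (inner ℝ P ξ ^ 2) * (2 * hκ1 - κ * hκP - hκ1)
    rw [Set.mem_preimage, mem_ball_zero_iff, Real.lt_sqrt (norm_nonneg _), ← h1]
    rfl
  rw [hset, Measure.addHaar_preimage_linearMap _ hdet0.ne', Measure.addHaar_ball _ _
    (Real.sqrt_nonneg R), ← mul_assoc, ← ENNReal.ofReal_mul (abs_nonneg _),
    finrank_euclideanSpace_fin, abs_of_pos (inv_pos.mpr hdet0), hdet]

/-- The bases are nonnegative, the last one because 4μ² ≤ 1, so the powers d/2 become natural powers
of square roots. -/
theorem pairG_eq {d : ℕ} (P : EuclideanSpace ℝ (Fin d)) {M μ u g : ℝ} (hM : 0 < M)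
    (hμ : 4 * μ ^ 2 ≤ 1) (hu : 0 ≤ u) (hg : g = √(‖P‖ ^ 2 + M ^ 2)) :
    pairG P M μ u =
      3 * volume.real (Metric.ball (0 : EuclideanSpace ℝ (Fin d)) 1) / (4 * Real.pi) ^ d *
        (√u ^ d * (u + g) * √(u + 2 * g) ^ d / √(u ^ 2 + 2 * u * g + M ^ 2)) *
        √((u ^ 2 + 2 * u * g + (1 - 4 * μ ^ 2) * M ^ 2) / (u ^ 2 + 2 * u * g + M ^ 2)) ^ d := by
  have hg0 : 0 ≤ g := hg ▸ Real.sqrt_nonneg _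
  have h1 : 0 ≤ 1 - 4 * μ ^ 2 := by linarith
  unfold pairG
  simp only [← hg]
  rw [Real.rpow_div_two_eq_sqrt _ hu, Real.rpow_div_two_eq_sqrt _ (by positivity),
    Real.rpow_div_two_eq_sqrt _ (by positivity), Real.rpow_natCast, Real.rpow_natCast,
    Real.rpow_natCast]

theorem four_mul_halfMassDifference_sq_le_one {mp mm : ℝ} (hmp : 0 < mp) (hmm : 0 < mm) :
    4 * ((mm / (mp + mm) - mp / (mp + mm)) / 2) ^ 2 ≤ 1 := by
  have h : 4 * ((mm / (mp + mm) - mp / (mp + mm)) / 2) ^ 2 = (mm - mp) ^ 2 / (mp + mm) ^ 2 := by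
    field_simp
    ring
  rw [h, div_le_one (by positivity)]
  nlinarith [mul_pos hmp hmm]

/-- The phase-space volume `|{T < u}|` in terms of the function `G`. -/
theorem volume_pairSymbol_lt {d : ℕ} (hd : 0 < d) (P : EuclideanSpace ℝ (Fin d)) {mp mm u : ℝ}
    (hmp : 0 < mp) (hmm : 0 < mm) (hu : 0 ≤ u) :
    volume {η : EuclideanSpace ℝ (Fin d) | pairSymbol P mp mm η < u} =
      ENNReal.ofReal ((2 * Real.pi) ^ d / 3 *
        pairG P (mp + mm) ((mm / (mp + mm) - mp / (mp + mm)) / 2) u) := by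
  have hM : 0 < mp + mm := by positivity
  set g := √(‖P‖ ^ 2 + (mp + mm) ^ 2) with hg
  have hg2 : g ^ 2 = ‖P‖ ^ 2 + (mp + mm) ^ 2 := Real.sq_sqrt (by positivity)
  have hg0 : 0 < g := Real.sqrt_pos.mpr (by positivity)
  set s := u + g with hs
  have hs0 : 0 < s := by positivity
  have hDeq : s ^ 2 - ‖P‖ ^ 2 = u ^ 2 + 2 * u * g + (mp + mm) ^ 2 := by
    rw [hs]
    linear_combination hg2
  set D := s ^ 2 - ‖P‖ ^ 2 with hD
  have hD0 : 0 < D := by rw [hDeq]; positivity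
  set c := mm / (mp + mm) - (D + mm ^ 2 - mp ^ 2) / (2 * D) with hc
  -- Here 4 μ̃² M² = (mm - mp)², so this factor of G is one of those in the radius of the ellipsoid.
  have hq : u ^ 2 + 2 * u * g + (1 - 4 * ((mm / (mp + mm) - mp / (mp + mm)) / 2) ^ 2) *
      (mp + mm) ^ 2 = D - (mm - mp) ^ 2 := by
    rw [hDeq]
    field_simp
    ring
  have hq0 : 0 ≤ D - (mm - mp) ^ 2 := by
    rw [hDeq]
    have : 0 ≤ u ^ 2 + 2 * u * g := by positivity
    nlinarith [mul_pos hmp hmm]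
  have hw : D - (mp + mm) ^ 2 = u * (u + 2 * g) := by rw [hDeq]; ring
  have hR : s ^ 2 * (D - (mp + mm) ^ 2) * (D - (mm - mp) ^ 2) / (4 * D) =
      (s / 2) ^ 2 * (u * ((u + 2 * g) * ((D - (mm - mp) ^ 2) / D))) := by
    rw [hw]
    field_simp
    ring
  have hset : {η : EuclideanSpace ℝ (Fin d) | pairSymbol P mp mm η < u} =
      (fun η => η + c • P) ⁻¹' {ξ | s ^ 2 * ‖ξ‖ ^ 2 - inner ℝ P ξ ^ 2 <
        s ^ 2 * (D - (mp + mm) ^ 2) * (D - (mm - mp) ^ 2) / (4 * D)} := by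
    ext η
    exact pairSymbol_lt_iff P η hmp hmm hu hs hD
  rw [hset, measure_preimage_add_right, volume_ellipsoid hd P hs0 hD0,
    ← ofReal_measureReal (measure_ball_lt_top.ne), ← ENNReal.ofReal_mul (by positivity),
    pairG_eq P hM (four_mul_halfMassDifference_sq_le_one hmp hmm) hu hg, hq, ← hDeq, hR,
    Real.sqrt_mul (by positivity), Real.sqrt_sq (by positivity), Real.sqrt_mul hu,
    Real.sqrt_mul (by positivity)]
  congr 1
  have h4 : (4 * Real.pi) ^ d = 2 ^ d * (2 * Real.pi) ^ d := by
    rw [← mul_pow]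
    ring
  have hr0 : 0 < √D := Real.sqrt_pos.mpr hD0
  rw [h4, mul_pow, mul_pow, mul_pow, div_pow s 2 d]
  have : 0 < Real.pi := Real.pi_pos
  field_simp
  rw [← hD, ← hs]
  field_simp

/-! ### Growth of G and the integral of 1/τ -/

theorem pairG_nonneg {d : ℕ} (P : EuclideanSpace ℝ (Fin d)) {M μ u : ℝ} (hM : 0 < M)
    (hμ : 4 * μ ^ 2 ≤ 1) (hu : 0 ≤ u) : 0 ≤ pairG P M μ u := by
  rw [pairG_eq P hM hμ hu rfl]
  have := Real.pi_pos
  positivity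

/-- For `d ≥ 4` the function `u ↦ u ^ (-3/2) G(u)` is nondecreasing. -/
theorem pairG_le_of_le {d : ℕ} (hd : 4 ≤ d) (P : EuclideanSpace ℝ (Fin d)) {M μ t u : ℝ}
    (hM : 0 < M) (hμ : 4 * μ ^ 2 ≤ 1) (ht : 0 < t) (htu : t ≤ u) :
    pairG P M μ t ≤ (√t / √u) ^ 3 * pairG P M μ u := by
  obtain ⟨k, rfl⟩ := Nat.exists_eq_add_of_le hd
  have hu : 0 < u := ht.trans_le htu
  set g := √(‖P‖ ^ 2 + M ^ 2) with hg
  have hg0 : 0 < g := Real.sqrt_pos.mpr (by positivity)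
  set C := 3 * volume.real (Metric.ball (0 : EuclideanSpace ℝ (Fin (4 + k))) 1) /
    (4 * Real.pi) ^ (4 + k) with hC
  have hC0 : 0 ≤ C := by
    have := Real.pi_pos
    positivity
  have hμ' : 0 ≤ 1 - 4 * μ ^ 2 := by linarith
  -- One factor √x √(x + 2g) is joined to the denominator so that each quotient is nondecreasing.
  -- Since d = 4 + k, the power √x ^ 3 still splits off.
  let φ : ℝ → ℝ := fun x => (√x * √(x + 2 * g)) ^ k *
    √((x ^ 2 + 2 * x * g) / (x ^ 2 + 2 * x * g + M ^ 2)) * √(x + 2 * g) ^ 3 * (x + g) *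
    √((x ^ 2 + 2 * x * g + (1 - 4 * μ ^ 2) * M ^ 2) / (x ^ 2 + 2 * x * g + M ^ 2)) ^ (4 + k)
  have hφ : ∀ x, 0 < x → pairG P M μ x = C * (√x ^ 3 * φ x) := by
    intro x hx
    rw [pairG_eq P hM hμ hx.le hg, ← hC]
    simp only [φ]
    have h1 : √((x ^ 2 + 2 * x * g) / (x ^ 2 + 2 * x * g + M ^ 2)) =
        √x * √(x + 2 * g) / √(x ^ 2 + 2 * x * g + M ^ 2) := by
      rw [Real.sqrt_div (by positivity), ← Real.sqrt_mul hx.le]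
      congr 2
      ring
    rw [h1]
    ring
  have hw : t ^ 2 + 2 * t * g ≤ u ^ 2 + 2 * u * g := by gcongr
  have hw0 : 0 < t ^ 2 + 2 * t * g := by positivity
  have hmono : φ t ≤ φ u := by
    simp only [φ]
    have h1 : (t ^ 2 + 2 * t * g) / (t ^ 2 + 2 * t * g + M ^ 2) ≤
        (u ^ 2 + 2 * u * g) / (u ^ 2 + 2 * u * g + M ^ 2) := by
      rw [div_le_div_iff₀ (by positivity) (by positivity)]
      nlinarith [sq_nonneg M]
    have h2 : (t ^ 2 + 2 * t * g + (1 - 4 * μ ^ 2) * M ^ 2) / (t ^ 2 + 2 * t * g + M ^ 2) ≤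
        (u ^ 2 + 2 * u * g + (1 - 4 * μ ^ 2) * M ^ 2) / (u ^ 2 + 2 * u * g + M ^ 2) := by
      rw [div_le_div_iff₀ (by positivity) (by positivity)]
      have : 0 ≤ μ ^ 2 * M ^ 2 := by positivity
      nlinarith
    gcongr
  rw [hφ t ht, hφ u hu]
  have hsu : 0 < √u := Real.sqrt_pos.mpr hu
  calc C * (√t ^ 3 * φ t) ≤ C * (√t ^ 3 * φ u) := by gcongr
    _ = _ := by field_simp

/-- If the distribution function of `τ` satisfies `N(t) ≤ (t / u) ^ (3/2) N(u)` for `t ≤ u`, then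
`∫_{τ < u} 1 / τ ≤ 3 N(u) / u`. -/
theorem setLIntegral_inv_le {X : Type*} [MeasurableSpace X] {μ : Measure X} {τ : X → ℝ}
    (hτ : Measurable τ) (hpos : ∀ᵐ x ∂μ, 0 < τ x) {u : ℝ} (hu : 0 < u)
    (hN : ∀ t, 0 < t → t ≤ u →
      μ {x | τ x < t} ≤ ENNReal.ofReal ((√t / √u) ^ 3) * μ {x | τ x < u}) :
    ∫⁻ x in {x | τ x < u}, ENNReal.ofReal (τ x)⁻¹ ∂μ ≤
      ENNReal.ofReal (3 / u) * μ {x | τ x < u} := by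
  have hS : MeasurableSet {x | τ x < u} := measurableSet_lt hτ measurable_const
  have hpos' : ∀ᵐ x ∂μ.restrict {x | τ x < u}, 0 < τ x := ae_restrict_of_ae hpos
  have hnn : 0 ≤ᵐ[μ.restrict {x | τ x < u}] fun x => (τ x)⁻¹ := by
    filter_upwards [hpos'] with x hx
    exact (inv_pos.mpr hx).le
  -- Layer cake. Heights t ≤ 1/u contribute N(u)/u; for t > 1/u the growth hypothesis bounds the
  -- measure by (t u)^(-3/2) N(u), whose integral is 2 N(u)/u.
  rw [lintegral_eq_lintegral_meas_lt (f := fun x => (τ x)⁻¹) _ hnn hτ.inv.aemeasurable]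
  have hui : 0 < u⁻¹ := inv_pos.mpr hu
  have hsplit : Set.Ioi (0 : ℝ) = Set.Ioc 0 u⁻¹ ∪ Set.Ioi u⁻¹ :=
    (Set.Ioc_union_Ioi_eq_Ioi hui.le).symm
  set N := μ {x | τ x < u} with hNdef
  have h1 : ∫⁻ t in Set.Ioc 0 u⁻¹, (μ.restrict {x | τ x < u}) {x | t < (τ x)⁻¹} ≤
      ENNReal.ofReal u⁻¹ * N := by
    calc _ ≤ ∫⁻ _t in Set.Ioc 0 u⁻¹, N := by
          refine lintegral_mono fun t => (measure_mono (Set.subset_univ _)).trans (le_of_eq ?_)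
          rw [Measure.restrict_apply_univ]
      _ = _ := by
          rw [setLIntegral_const, Real.volume_Ioc, sub_zero, mul_comm]
  have h2 : ∫⁻ t in Set.Ioi u⁻¹, (μ.restrict {x | τ x < u}) {x | t < (τ x)⁻¹} ≤
      ENNReal.ofReal (2 * u⁻¹) * N := by
    have hint := integrableOn_Ioi_rpow_of_lt (by norm_num : (-(3 / 2) : ℝ) < -1) hui
    calc _ ≤ ∫⁻ t in Set.Ioi u⁻¹, ENNReal.ofReal ((√u ^ 3)⁻¹ * t ^ (-(3 / 2) : ℝ)) * N := by
          refine setLIntegral_mono' measurableSet_Ioi fun t ht => ?_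
          have ht' : u⁻¹ < t := ht
          have ht0 : 0 < t := hui.trans ht'
          have h3 : (μ.restrict {x | τ x < u}) {x | t < (τ x)⁻¹} ≤ μ {x | τ x < t⁻¹} := by
            refine (Measure.restrict_apply_le _ _).trans (measure_mono_ae ?_)
            filter_upwards [hpos] with x hx h
            exact (lt_inv_comm₀ ht0 hx).mp h
          refine h3.trans ((hN _ (inv_pos.mpr ht0) ((inv_le_comm₀ ht0 hu).mpr ht'.le)).trans
            (le_of_eq ?_))
          congr 2
          rw [div_pow, div_eq_inv_mul, Real.sqrt_inv, Real.rpow_neg ht0.le,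
            Real.rpow_div_two_eq_sqrt _ ht0.le, inv_pow]
          norm_num
      _ = ENNReal.ofReal (∫ t in Set.Ioi u⁻¹, (√u ^ 3)⁻¹ * t ^ (-(3 / 2) : ℝ)) * N := by
          rw [lintegral_mul_const _ (by fun_prop), ofReal_integral_eq_lintegral_ofReal
            (hint.const_mul _)]
          filter_upwards [ae_restrict_mem measurableSet_Ioi] with t ht
          have ht0 : 0 < t := hui.trans ht
          simp only [Pi.zero_apply]
          positivity
      _ = _ := by
          rw [integral_const_mul, integral_Ioi_rpow_of_lt (by norm_num) hui]
          congr 2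
          have h4 : (u⁻¹ : ℝ) ^ (-(3 / 2) + 1 : ℝ) = √u := by
            rw [Real.inv_rpow hu.le, ← Real.rpow_neg hu.le, Real.sqrt_eq_rpow]
            norm_num
          have h5 : 0 < √u := Real.sqrt_pos.mpr hu
          have h6 : √u ^ 2 = u := Real.sq_sqrt hu.le
          rw [h4]
          field_simp
          rw [h6]
          norm_num
  rw [hsplit]
  refine (lintegral_union_le _ _ _).trans ((add_le_add h1 h2).trans (le_of_eq ?_))
  rw [← add_mul, ← ENNReal.ofReal_add (by positivity) (by positivity)]
  congr 2
  field_simp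
  norm_num

/-! ### Application to the pair operator -/

theorem continuous_pairSymbol {d : ℕ} (P : EuclideanSpace ℝ (Fin d)) (mp mm : ℝ) :
    Continuous (pairSymbol P mp mm) := by
  unfold pairSymbol
  fun_prop

/-- The distribution function of the kinetic energy on the Fourier side is `G / 3`. -/
theorem volume_pairSymbol_smul_lt {d : ℕ} (hd : 0 < d) (P : EuclideanSpace ℝ (Fin d))
    {mp mm u : ℝ} (hmp : 0 < mp) (hmm : 0 < mm) (hu : 0 ≤ u) :
    volume {ξ : EuclideanSpace ℝ (Fin d) | pairSymbol P mp mm ((2 * Real.pi) • ξ) < u} =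
      ENNReal.ofReal (pairG P (mp + mm) ((mm / (mp + mm) - mp / (mp + mm)) / 2) u / 3) := by
  have hpi := Real.pi_pos
  have h := Measure.addHaar_preimage_smul (volume : Measure (EuclideanSpace ℝ (Fin d)))
    (by positivity : (2 * Real.pi : ℝ) ≠ 0) {η | pairSymbol P mp mm η < u}
  rw [finrank_euclideanSpace_fin, volume_pairSymbol_lt hd P hmp hmm hu, ← ENNReal.ofReal_mul
    (abs_nonneg _), abs_of_pos (by positivity)] at h
  refine h.trans ?_
  congr 1
  field_simp

/-- The set {τ ≤ 0} lies in {τ < t} for every t > 0, whose measure is at most t^(3/2) G(1)/3 for t ≤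
1 and tends to 0. -/
theorem pairSymbol_smul_pos_ae {d : ℕ} (hd : 4 ≤ d) (P : EuclideanSpace ℝ (Fin d))
    {mp mm : ℝ} (hmp : 0 < mp) (hmm : 0 < mm) :
    ∀ᵐ ξ : EuclideanSpace ℝ (Fin d), 0 < pairSymbol P mp mm ((2 * Real.pi) • ξ) := by
  have hd0 : 0 < d := by omega
  have hM : 0 < mp + mm := by positivity
  have hμ := four_mul_halfMassDifference_sq_le_one hmp hmm
  set G := pairG P (mp + mm) ((mm / (mp + mm) - mp / (mp + mm)) / 2) with hG
  rw [ae_iff]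
  have hle : ∀ t : ℝ, 0 < t → t ≤ 1 →
      volume {ξ : EuclideanSpace ℝ (Fin d) | ¬ 0 < pairSymbol P mp mm ((2 * Real.pi) • ξ)} ≤
        ENNReal.ofReal ((√t / √1) ^ 3 * G 1 / 3) := fun t ht ht1 => by
    refine (measure_mono fun ξ hξ => ?_).trans
      ((volume_pairSymbol_smul_lt hd0 P hmp hmm ht.le).le.trans (ENNReal.ofReal_le_ofReal ?_))
    · exact (not_lt.mp hξ).trans_lt ht
    · have := pairG_le_of_le hd P hM hμ ht ht1
      gcongr
  have hlim : Filter.Tendsto (fun t : ℝ => ENNReal.ofReal ((√t / √1) ^ 3 * G 1 / 3))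
      (nhdsWithin 0 (Set.Ioi 0)) (nhds 0) := by
    have h1 : Continuous fun t : ℝ => ENNReal.ofReal ((√t / √1) ^ 3 * G 1 / 3) :=
      ENNReal.continuous_ofReal.comp (by fun_prop)
    have h2 := (h1.tendsto 0).mono_left (nhdsWithin_le_nhds (s := Set.Ioi 0))
    simpa using h2
  refine nonpos_iff_eq_zero.mp (ge_of_tendsto hlim ?_)
  filter_upwards [Ioc_mem_nhdsGT (zero_lt_one' ℝ)] with t ht
  exact hle t ht.1 ht.2

/-- The factor 3 from the layer-cake bound cancels the one in |{τ < u}| = G(u)/3. -/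
theorem setLIntegral_inv_pairSymbol_le {d : ℕ} (hd : 4 ≤ d) (P : EuclideanSpace ℝ (Fin d))
    {mp mm u : ℝ} (hmp : 0 < mp) (hmm : 0 < mm) (hu : 0 < u) :
    ∫⁻ ξ in {ξ : EuclideanSpace ℝ (Fin d) | pairSymbol P mp mm ((2 * Real.pi) • ξ) < u},
        ENNReal.ofReal (pairSymbol P mp mm ((2 * Real.pi) • ξ))⁻¹ ≤
      ENNReal.ofReal (pairG P (mp + mm) ((mm / (mp + mm) - mp / (mp + mm)) / 2) u / u) := by
  have hd0 : 0 < d := by omega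
  have hM : 0 < mp + mm := by positivity
  have hμ := four_mul_halfMassDifference_sq_le_one hmp hmm
  have h := setLIntegral_inv_le (μ := volume)
    (τ := fun ξ : EuclideanSpace ℝ (Fin d) => pairSymbol P mp mm ((2 * Real.pi) • ξ))
    ((continuous_pairSymbol P mp mm).measurable.comp (measurable_const_smul _))
    (pairSymbol_smul_pos_ae hd P hmp hmm) hu fun t ht htu => ?_
  · refine h.trans (le_of_eq ?_)
    rw [volume_pairSymbol_smul_lt hd0 P hmp hmm hu.le, ← ENNReal.ofReal_mul (by positivity)]
    congr 1
    field_simp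
  · rw [volume_pairSymbol_smul_lt hd0 P hmp hmm ht.le, volume_pairSymbol_smul_lt hd0 P hmp hmm hu.le,
      ← ENNReal.ofReal_mul (by positivity)]
    apply ENNReal.ofReal_le_ofReal
    have := pairG_le_of_le hd P hM hμ ht htu
    linarith

theorem theorem3p6 (d : ℕ) (hd : 4 ≤ d) (P : EuclideanSpace ℝ (Fin d)) (mp mm : ℝ)
    (hmp : 0 < mp) (hmm : 0 < mm) :
    (∀ u : ℝ, 0 ≤ u →
      volume {η : EuclideanSpace ℝ (Fin d) | pairSymbol P mp mm η < u} ≠ ⊤ ∧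
      pairG P (mp + mm) ((mm / (mp + mm) - mp / (mp + mm)) / 2) u =
        3 / (2 * Real.pi) ^ d *
          volume.real {η : EuclideanSpace ℝ (Fin d) | pairSymbol P mp mm η < u}) ∧
    ∀ (V : EuclideanSpace ℝ (Fin d) → ℝ) (hV : AEMeasurable V volume),
      IsRelativelyFormCompact (pairSymbol P mp mm) V →
      ∀ α : ℝ, 0 < α → α < 1 / 4 →
        negativeEigenvalueCount (pairSymbol P mp mm) V hV ≤
          ENNReal.ofReal (α ^ 2 / (1 - 4 * α) ^ 2) *
            ∫⁻ x, ENNReal.ofReal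
              (pairG P (mp + mm) ((mm / (mp + mm) - mp / (mp + mm)) / 2)
                (max 0 (-V x) / α ^ 2)) := by
  have hd0 : 0 < d := by omega
  have hM : 0 < mp + mm := by positivity
  have hμ := four_mul_halfMassDifference_sq_le_one hmp hmm
  have hpi := Real.pi_pos
  constructor
  · intro u hu
    have hvol := volume_pairSymbol_lt hd0 P hmp hmm hu
    have hG := pairG_nonneg P hM hμ hu
    refine ⟨by rw [hvol]; exact ENNReal.ofReal_ne_top, ?_⟩
    rw [Measure.real, hvol, ENNReal.toReal_ofReal (by positivity)]
    field_simp
  · intro V hV _ α hα hα4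
    have hβ : 0 < 1 - 4 * α := by linarith
    refine (negativeEigenvalueCount_le_phaseSpace (continuous_pairSymbol P mp mm).measurable hV
      (pairSymbol_smul_pos_ae hd P hmp hmm) (fun t ht => ?_) (fun t ht => ?_) hα hα4).trans ?_
    · rw [volume_pairSymbol_smul_lt hd0 P hmp hmm ht.le]
      exact ENNReal.ofReal_ne_top
    · exact ((setLIntegral_inv_pairSymbol_le hd P hmp hmm ht).trans_lt ENNReal.ofReal_lt_top).ne
    · rw [ENNReal.div_eq_inv_mul, ENNReal.ofReal_div_of_pos (by positivity),
        ENNReal.div_eq_inv_mul, mul_assoc]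
      gcongr
      rw [← lintegral_const_mul' _ _ ENNReal.ofReal_ne_top]
      refine lintegral_mono fun x => ?_
      rcases (le_max_left 0 (-V x)).eq_or_lt with h0 | h0
      · rw [← h0, ENNReal.ofReal_zero, zero_mul]
        exact zero_le
      · have hq : 0 < max 0 (-V x) / α ^ 2 := by positivity
        refine (mul_le_mul' le_rfl (setLIntegral_inv_pairSymbol_le hd P hmp hmm hq)).trans
          (le_of_eq ?_)
        rw [← ENNReal.ofReal_mul h0.le, ← ENNReal.ofReal_mul (by positivity)]
        congr 1
        field_simp
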